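/- Let $d\ge 2$, $0\le r_0<r_1\le\infty$, $A(r_0,r_1)=\{x\in\mathbb R^d: r_0<|x|<r_1\}$, and let $\tau\ge 0$. Let $f:A(r_0,r_1)\to\mathbb C$ be polyharmonic of infinite order and type $\tau$, i.e. $f$ is $C^\infty$ and for every compact $K\subset A(r_0,r_1)$ and every $\varepsilon>0$ there is $C_{K,\varepsilon}>0$ with $$\max_{x\in K}|\Delta^p f(x)|\le C_{K,\varepsilon}\,(2p)!\,(\tau+\varepsilon)^{2p}\qquad\text{for all } p\in\mathbb N_0 .$$ For each $k\in\mathbb N_0$ let $Y_{k,l}$, $l=1,\dots,a_k$, be a basis of the complex vector space of harmonic homogeneous polynomials of degree $k$ in $d$ variables that is orthonormal with respect to $\langle g,h\rangle=\int_{\mathbb S^{d-1}}g(\theta)\overline{h(\theta)}\,d\theta$, where $d\theta$ is the surface measure, and let $$f_{k,l}(r)=\int_{\mathbb S^{d-1}}f(r\theta)\overline{Y_{k,l}(\theta)}\,d\theta\quad(r_0<r<r_1),\qquad \tilde f_{k,l}(v)=f_{k,l}(e^v)\quad(\log r_0<v<\log r_1).$$ Put $\lambda_{2j}=k+2j$ and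 $\lambda_{2j+1}=-k-d+2+2j$ for $j\in\mathbb N_0$, let $$D^{(n)}g=\Big(\frac{d}{dv}-\lambda_0\Big)\cdots\Big(\frac{d}{dv}-\lambda_{n-1}\Big)g,\qquad \Phi_n(v)=\frac1{2\pi i}\oint\frac{e^{vz}}{(z-\lambda_0)\cdots(z-\lambda_n)}\,dz,$$ the integral being taken over a circle around $0$ that surrounds $\lambda_0,\dots,\lambda_n$. Then, for all $k\in\mathbb N_0$ and $l\in\{1,\dots,a_k\}$: (i) For every $v_0\in(\log r_0,\log r_1)$ the series $$\sum_{n=0}^\infty D^{(n)}\tilde f_{k,l}(v_0)\,\Phi_n(v-v_0)$$ converges absolutely, and uniformly on compact subsets, in the open disc in $\mathbb C$ with center $v_0$ and radius $\ln\big(1+\frac{1}{e^{v_0}\tau}\big)$ (understood as $\infty$ if $\tau=0$). Its sum is analytic in this disc and equals $\tilde f_{k,l}(v)$ for all real $v\in(\log r_0,\log r_1)$ that lie in the disc. (ii) If $\tau=0$, then $\tilde f_{k,l}$ is the restriction to $(\log r_0,\log r_1)$ of an entire function, and $f_{k,l}$ possesses an analytic extension from $(r_0,r_1)$ to $\mathbb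 C\setminus(-\infty,0]$. -/

import Mathlib

open scoped ContDiff

noncomputable section

namespace Polyharmonic

/-- The annular region `{x ∈ ℝ^d : r₀ < |x| < r₁}`; the outer radius may be `∞`. -/
def annulus (d : ℕ) (r₀ : ℝ) (r₁ : EReal) : Set (EuclideanSpace ℝ (Fin d)) :=
  {x | r₀ < ‖x‖ ∧ ((‖x‖ : ℝ) : EReal) < r₁}

/-- `f` is polyharmonic of infinite order and type `τ` on the open set `G`: it is smooth on `G`
and for every compact `K ⊆ G` and `ε > 0` there is `C > 0` such that
`|Δ^p f (x)| ≤ C (2p)! (τ + ε)^(2p)` for all `x ∈ K` and all `p`. -/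
def IsPolyharmonicOfType {d : ℕ} (G : Set (EuclideanSpace ℝ (Fin d))) (τ : ℝ)
    (f : EuclideanSpace ℝ (Fin d) → ℂ) : Prop :=
  ContDiffOn ℝ ∞ f G ∧
    ∀ K : Set (EuclideanSpace ℝ (Fin d)), K ⊆ G → IsCompact K → ∀ ε : ℝ, 0 < ε →
      ∃ C : ℝ, 0 < C ∧ ∀ p : ℕ, ∀ x ∈ K,
        ‖((Laplacian.laplacian : (EuclideanSpace ℝ (Fin d) → ℂ) →
            EuclideanSpace ℝ (Fin d) → ℂ)^[p] f) x‖ ≤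
          C * ((2 * p).factorial : ℝ) * (τ + ε) ^ (2 * p)

/-- The Laplace operator `∂²/∂x₁² + ⋯ + ∂²/∂x_d²` on polynomials. -/
def polyLaplacian (d : ℕ) : MvPolynomial (Fin d) ℂ →ₗ[ℂ] MvPolynomial (Fin d) ℂ :=
  ∑ i : Fin d, (MvPolynomial.pderiv (R := ℂ) i).toLinearMap ∘ₗ
    (MvPolynomial.pderiv (R := ℂ) i).toLinearMap

/-- The complex vector space of harmonic homogeneous polynomials of degree `k` in `d` variables. -/
def harmonicHomogeneous (d k : ℕ) : Submodule ℂ (MvPolynomial (Fin d) ℂ) :=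
  MvPolynomial.homogeneousSubmodule (Fin d) ℂ k ⊓ LinearMap.ker (polyLaplacian d)

/-- The dimension `a_k` of the space of harmonic homogeneous polynomials of degree `k`. -/
def harmonicDim (d k : ℕ) : ℕ := Module.finrank ℂ (harmonicHomogeneous d k)

/-- The value of a complex polynomial at a point of `ℝ^d`. -/
def evalReal {d : ℕ} (P : MvPolynomial (Fin d) ℂ) (x : EuclideanSpace ℝ (Fin d)) : ℂ :=
  MvPolynomial.eval (fun i => ((x i : ℝ) : ℂ)) P

/-- The scalar product `∫ P(θ) conj(Q(θ)) dθ` over the unit sphere with its surface measure. -/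
def sphereInner {d : ℕ} (P Q : MvPolynomial (Fin d) ℂ) : ℂ :=
  ∫ θ : Metric.sphere (0 : EuclideanSpace ℝ (Fin d)) 1,
    evalReal P θ * (starRingEnd ℂ) (evalReal Q θ) ∂(MeasureTheory.volume.toSphere)

/-- The Fourier-Laplace coefficient `r ↦ ∫ f(rθ) conj(Y(θ)) dθ` of `f` with respect to `Y`. -/
def fourierLaplaceCoeff {d : ℕ} (f : EuclideanSpace ℝ (Fin d) → ℂ) (Y : MvPolynomial (Fin d) ℂ)
    (r : ℝ) : ℂ :=
  ∫ θ : Metric.sphere (0 : EuclideanSpace ℝ (Fin d)) 1,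
    f (r • (θ : EuclideanSpace ℝ (Fin d))) * (starRingEnd ℂ) (evalReal Y θ)
      ∂(MeasureTheory.volume.toSphere)

/-- The exponents `λ_{2j} = k + 2j` and `λ_{2j+1} = -k - d + 2 + 2j`. -/
def exponent (d k n : ℕ) : ℂ :=
  if Even n then (k : ℂ) + 2 * ((n / 2 : ℕ) : ℂ)
  else -(k : ℂ) - (d : ℂ) + 2 + 2 * ((n / 2 : ℕ) : ℂ)

/-- `D^(n) g = (d/dv - λ₀) ⋯ (d/dv - λ_{n-1}) g`; the order of the factors is immaterial for
smooth `g`. -/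
def genDeriv (lam : ℕ → ℂ) : ℕ → (ℝ → ℂ) → ℝ → ℂ
  | 0, g => g
  | n + 1, g => fun v => deriv (genDeriv lam n g) v - lam n * genDeriv lam n g v

/-- The fundamental function of `(d/dx - λ₀) ⋯ (d/dx - λ_n)`,
`Φ_n(x) = (1 / 2πi) ∮ e^{xz} / ((z - λ₀) ⋯ (z - λ_n)) dz`, where the integral is over a circle
around `0` that surrounds `λ₀, …, λ_n`. -/
def fundamentalFunction (lam : ℕ → ℂ) (n : ℕ) (x : ℂ) : ℂ :=
  (2 * (Real.pi : ℂ) * Complex.I)⁻¹ *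
    ∮ z in C(0, 1 + ∑ j ∈ Finset.range (n + 1), ‖lam j‖),
      Complex.exp (x * z) / ∏ j ∈ Finset.range (n + 1), (z - lam j)

/-- The `n`-th term `D^(n) g(v₀) Φ_n(z - v₀)` of the generalized Taylor series of `g` at `v₀`. -/
def taylorTerm (lam : ℕ → ℂ) (g : ℝ → ℂ) (v₀ : ℝ) (n : ℕ) (z : ℂ) : ℂ :=
  genDeriv lam n g v₀ * fundamentalFunction lam n (z - (v₀ : ℂ))

/-- The open disc in `ℂ` with center `v₀` and radius `ln (1 + 1 / (e^{v₀} τ))`, where the radius is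
`∞` for `τ = 0`. -/
def convergenceDisc (τ v₀ : ℝ) : Set ℂ :=
  if τ = 0 then Set.univ
  else Metric.ball (v₀ : ℂ) (Real.log (1 + 1 / (Real.exp v₀ * τ)))

end Polyharmonic

end

/-!
In logarithmic polar coordinates `x = e^v θ` the operator `|x|² Δ` is
`∂_v² + (d - 2) ∂_v + Δ_S`, and `Δ_S` acts on `Y_{k,l}` by `-k (k + d - 2)`. Hence
`(d/dv - λ₀) (d/dv - λ₁)` sends the coefficient of `f` to `e^{2v}` times that of `Δ f`; since
`λ_{n+2} = λ_n + 2`, the factor `e^{2v}` is absorbed by the next pair of exponents, and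
`D^{(2p)} f̃ = e^{2pv} · (coefficient of Δ^p f)`. The type of `f` thus bounds the generalized
derivatives of even order by `C n! (e^v ρ)^n` for every `ρ > τ`; an interpolation inequality gives
the same for odd order.

With `|λ_n| ≤ b + n`, the first-order recursion for the fundamental functions yields
`|Φ_n(z)| ≤ e^{br} (e^r - 1)^n / n!`, where `r = |z|`, so the series is dominated by a geometric
series with ratio `e^{v₀} ρ (e^r - 1)`, and this is less than `1` in the disc. The remainder is an
integral of `D^{(N+1)} f̃(t) Φ_N(v - t)` and is controlled in the same way, because
`e^t (e^{|v - t|} - 1) ≤ e^{v₀} (e^{|v - v₀|} - 1)` for `t` between `v₀` and `v`.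
-/

noncomputable section

open MeasureTheory Set Filter Topology

namespace Polyharmonic

section ParametricIntegral

variable {E : Type*} [NormedAddCommGroup E]

lemma hasDerivAt_setIntegral_of_isCompact [NormedSpace ℝ E] {𝕜 X : Type*} [RCLike 𝕜]
    [NormedSpace 𝕜 E] [TopologicalSpace X] [MeasurableSpace X] [OpensMeasurableSpace X]
    [R1Space X] {μ : Measure X} [IsFiniteMeasureOnCompacts μ] {K : Set X} (hK : IsCompact K)
    (hKm : MeasurableSet K) {U : Set 𝕜} {F F' : 𝕜 → X → E} {x₀ : 𝕜} (hU : U ∈ 𝓝 x₀)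
    (hF : ∀ x ∈ U, ContinuousOn (F x) K)
    (hF' : ContinuousOn (Function.uncurry F') (U ×ˢ K))
    (h : ∀ x ∈ U, ∀ t ∈ K, HasDerivAt (F · t) (F' x t) x) :
    HasDerivAt (fun x => ∫ t in K, F x t ∂μ) (∫ t in K, F' x₀ t ∂μ) x₀ := by
  obtain ⟨ε, hε, hεU⟩ := Metric.nhds_basis_closedBall.mem_iff.1 hU
  obtain ⟨C, hC⟩ := ((isCompact_closedBall x₀ ε).prod hK).exists_bound_of_continuousOn
    (hF'.mono (prod_mono_left hεU))
  have hx₀ : x₀ ∈ U := mem_of_mem_nhds hU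
  have hF'x₀ : ContinuousOn (F' x₀) K :=
    hF'.comp (Continuous.prodMk_right x₀).continuousOn fun t ht => ⟨hx₀, ht⟩
  refine (hasDerivAt_integral_of_dominated_loc_of_deriv_le (bound := fun _ => C)
    (Metric.closedBall_mem_nhds x₀ hε) ?_ ((hF x₀ hx₀).integrableOn_compact' hK hKm)
    (hF'x₀.aestronglyMeasurable_of_isCompact hK hKm) ?_
    (integrableOn_const hK.measure_lt_top.ne) ?_).2
  · filter_upwards [hU] with x hx
    exact (hF x hx).aestronglyMeasurable_of_isCompact hK hKm
  · filter_upwards [ae_restrict_mem hKm] with t ht x hx using hC (x, t) ⟨hx, ht⟩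
  · filter_upwards [ae_restrict_mem hKm] with t ht x hx using h x (hεU hx) t ht

lemma hasDerivAt_circleIntegral [NormedSpace ℂ E] {F F' : ℂ → ℂ → E} {c : ℂ} {R : ℝ} (hR : 0 ≤ R)
    (hF : ∀ x, ContinuousOn (F x) (Metric.sphere c R))
    (hF' : ContinuousOn (Function.uncurry F') (univ ×ˢ Metric.sphere c R))
    (h : ∀ x, ∀ z ∈ Metric.sphere c R, HasDerivAt (F · z) (F' x z) x) (x₀ : ℂ) :
    HasDerivAt (fun x => ∮ z in C(c, R), F x z) (∮ z in C(c, R), F' x₀ z) x₀ := by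
  have hmem : ∀ t, circleMap c R t ∈ Metric.sphere c R := circleMap_mem_sphere c hR
  have hderiv : Continuous (deriv (circleMap c R)) := by
    simp only [funext (deriv_circleMap c R)]
    fun_prop
  simp only [circleIntegral, intervalIntegral.integral_of_le Real.two_pi_pos.le,
    ← integral_Icc_eq_integral_Ioc]
  refine hasDerivAt_setIntegral_of_isCompact isCompact_Icc measurableSet_Icc univ_mem
    (fun x _ => ?_) ?_ fun x _ t _ => (h x _ (hmem t)).const_smul (deriv (circleMap c R) t)
  · exact (hderiv.smul ((hF x).comp_continuous (continuous_circleMap c R) hmem)).continuousOn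
  · have hpair : Continuous fun p : ℂ × ℝ => (p.1, circleMap c R p.2) := by fun_prop
    exact ((hderiv.comp continuous_snd).smul
      (hF'.comp_continuous hpair fun p => ⟨trivial, hmem p.2⟩)).continuousOn

end ParametricIntegral

section FundamentalFunction

variable (lam : ℕ → ℂ)

/-- The radius of the contour in the definition of the fundamental function. -/
def contourRadius (n : ℕ) : ℝ := 1 + ∑ j ∈ Finset.range (n + 1), ‖lam j‖

lemma contourRadius_pos (n : ℕ) : 0 < contourRadius lam n := by
  unfold contourRadius
  positivity

lemma norm_lt_contourRadius {n j : ℕ} (hj : j ∈ Finset.range (n + 1)) :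
    ‖lam j‖ < contourRadius lam n := by
  have := Finset.single_le_sum (f := fun j => ‖lam j‖) (fun _ _ => norm_nonneg _) hj
  unfold contourRadius
  linarith

lemma contourRadius_le_succ (n : ℕ) : contourRadius lam n ≤ contourRadius lam (n + 1) := by
  unfold contourRadius
  rw [Finset.sum_range_succ _ (n + 1)]
  linarith [norm_nonneg (lam (n + 1))]

lemma prod_sub_ne_zero_of_contourRadius_le {n : ℕ} {z : ℂ} (hz : contourRadius lam n ≤ ‖z‖) :
    ∏ j ∈ Finset.range (n + 1), (z - lam j) ≠ 0 := by
  refine Finset.prod_ne_zero_iff.2 fun j hj h => ?_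
  rw [sub_eq_zero.1 h] at hz
  exact hz.not_gt (norm_lt_contourRadius lam hj)

lemma continuousOn_exp_div_prod {n : ℕ} {R : ℝ} (hR : contourRadius lam n ≤ R) (x : ℂ) :
    ContinuousOn (fun z => Complex.exp (x * z) / ∏ j ∈ Finset.range (n + 1), (z - lam j))
      (Metric.sphere 0 R) :=
  .div (by fun_prop) (by fun_prop) fun z hz =>
    prod_sub_ne_zero_of_contourRadius_le lam (by rwa [mem_sphere_zero_iff_norm.1 hz])

lemma fundamentalFunction_eq_of_contourRadius_le {n : ℕ} {R : ℝ} (hR : contourRadius lam n ≤ R)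
    (x : ℂ) :
    fundamentalFunction lam n x = (2 * (Real.pi : ℂ) * Complex.I)⁻¹ *
      ∮ z in C(0, R), Complex.exp (x * z) / ∏ j ∈ Finset.range (n + 1), (z - lam j) := by
  refine congrArg _ (Complex.circleIntegral_eq_of_differentiable_on_annulus_off_countable
    (contourRadius_pos lam n) hR countable_empty ?_ ?_).symm
  · refine .div (by fun_prop) (by fun_prop) fun z hz => ?_
    exact prod_sub_ne_zero_of_contourRadius_le lam (by simpa using hz.2)
  · rintro z ⟨⟨_, hz⟩, _⟩
    have hz' : contourRadius lam n < ‖z‖ := by simpa using hz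
    exact .fun_div (by fun_prop) (by fun_prop) (prod_sub_ne_zero_of_contourRadius_le lam hz'.le)

lemma fundamentalFunction_zero (x : ℂ) :
    fundamentalFunction lam 0 x = Complex.exp (lam 0 * x) := by
  have cauchy := Complex.circleIntegral_div_sub_of_differentiable_on_off_countable
    (R := contourRadius lam 0) (c := 0) (w := lam 0) (f := fun z => Complex.exp (x * z))
    countable_empty (mem_ball_zero_iff.2 (norm_lt_contourRadius lam (Finset.mem_range.2 one_pos)))
    (by fun_prop) (fun z _ => by fun_prop)
  rw [fundamentalFunction_eq_of_contourRadius_le lam le_rfl]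
  simp only [zero_add, Finset.prod_range_one]
  rw [cauchy, inv_mul_cancel_left₀ Complex.two_pi_I_ne_zero, mul_comm]

lemma norm_circleIntegral_one_div_prod_le {n : ℕ} {R : ℝ} (hR : 2 * contourRadius lam n ≤ R) :
    ‖∮ z in C(0, R), 1 / ∏ j ∈ Finset.range (n + 1), (z - lam j)‖ ≤
      4 * Real.pi * ((R / 2) ^ n)⁻¹ := by
  have hRpos : 0 < R := by linarith [contourRadius_pos lam n]
  calc ‖∮ z in C(0, R), 1 / ∏ j ∈ Finset.range (n + 1), (z - lam j)‖
      ≤ 2 * Real.pi * R * ((R / 2) ^ (n + 1))⁻¹ := by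
        refine circleIntegral.norm_integral_le_of_norm_le_const hRpos.le fun z hz => ?_
        rw [norm_div, norm_one, one_div, norm_prod]
        refine inv_anti₀ (by positivity) ?_
        suffices ∏ _j ∈ Finset.range (n + 1), R / 2 ≤ ∏ j ∈ Finset.range (n + 1), ‖z - lam j‖ by
          rwa [Finset.prod_const, Finset.card_range] at this
        refine Finset.prod_le_prod (fun _ _ => by positivity) fun j hj => ?_
        have hlam := norm_lt_contourRadius lam hj
        have hsub := norm_sub_norm_le z (lam j)
        rw [mem_sphere_zero_iff_norm.1 hz] at hsub
        linarith
    _ = 4 * Real.pi * ((R / 2) ^ n)⁻¹ := by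
        rw [pow_succ]
        field_simp
        ring

lemma fundamentalFunction_succ_apply_zero (n : ℕ) : fundamentalFunction lam (n + 1) 0 = 0 := by
  have hbound : ∀ᶠ R in atTop, ‖fundamentalFunction lam (n + 1) 0‖ ≤
      ‖(2 * (Real.pi : ℂ) * Complex.I)⁻¹‖ * (4 * Real.pi * ((R / 2) ^ (n + 1))⁻¹) := by
    filter_upwards [eventually_ge_atTop (2 * contourRadius lam (n + 1))] with R hR
    rw [fundamentalFunction_eq_of_contourRadius_le lam
      (by linarith [contourRadius_pos lam (n + 1)] : _ ≤ R), norm_mul]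
    simp only [zero_mul, Complex.exp_zero]
    gcongr
    exact norm_circleIntegral_one_div_prod_le lam hR
  have hpow : Tendsto (fun R : ℝ => ((R / 2) ^ (n + 1))⁻¹) atTop (𝓝 0) :=
    ((tendsto_pow_atTop n.succ_ne_zero).comp (tendsto_id.atTop_div_const two_pos)).inv_tendsto_atTop
  have hlim := (hpow.const_mul (4 * Real.pi)).const_mul ‖(2 * (Real.pi : ℂ) * Complex.I)⁻¹‖
  rw [mul_zero, mul_zero] at hlim
  exact norm_le_zero_iff.1 (ge_of_tendsto hlim hbound)

lemma hasDerivAt_fundamentalFunction_succ (n : ℕ) (x : ℂ) :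
    HasDerivAt (fundamentalFunction lam (n + 1))
      (lam (n + 1) * fundamentalFunction lam (n + 1) x + fundamentalFunction lam n x) x := by
  set R := contourRadius lam (n + 1)
  have hR : 0 ≤ R := (contourRadius_pos lam _).le
  have hne {z : ℂ} (hz : z ∈ Metric.sphere 0 R) :
      ∏ j ∈ Finset.range (n + 2), (z - lam j) ≠ 0 :=
    prod_sub_ne_zero_of_contourRadius_le lam (mem_sphere_zero_iff_norm.1 hz).ge
  have hcontour := (hasDerivAt_circleIntegral hR
    (F' := fun x z => z * Complex.exp (x * z) / ∏ j ∈ Finset.range (n + 2), (z - lam j))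
    (continuousOn_exp_div_prod lam le_rfl)
    (.div (by fun_prop) (by fun_prop) fun p hp => hne hp.2)
    (fun x z _ => by
      simpa [mul_comm] using (((hasDerivAt_id x).mul_const z).cexp).div_const _) x).const_mul
    (2 * (Real.pi : ℂ) * Complex.I)⁻¹
  refine hcontour.congr_deriv ?_
  have hsplit : EqOn
      (fun z => z * Complex.exp (x * z) / ∏ j ∈ Finset.range (n + 2), (z - lam j))
      (fun z => lam (n + 1) * (Complex.exp (x * z) / ∏ j ∈ Finset.range (n + 2), (z - lam j)) +
        Complex.exp (x * z) / ∏ j ∈ Finset.range (n + 1), (z - lam j)) (Metric.sphere 0 R) := by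
    intro z hz
    have hprod := hne hz
    simp only [Finset.prod_range_succ _ (n + 1)] at hprod ⊢
    have hleft := left_ne_zero_of_mul hprod
    have hright := right_ne_zero_of_mul hprod
    field_simp
    ring
  rw [circleIntegral.integral_congr hR hsplit, circleIntegral.integral_add,
    circleIntegral.integral_const_mul, mul_add, mul_left_comm,
    ← fundamentalFunction_eq_of_contourRadius_le lam le_rfl,
    ← fundamentalFunction_eq_of_contourRadius_le lam (contourRadius_le_succ lam n)]
  · exact (continuousOn_const.mul (continuousOn_exp_div_prod lam le_rfl x)).circleIntegrable hR
  · exact (continuousOn_exp_div_prod lam (contourRadius_le_succ lam n) x).circleIntegrable hR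

lemma hasDerivAt_fundamentalFunction_zero (x : ℂ) :
    HasDerivAt (fundamentalFunction lam 0) (lam 0 * fundamentalFunction lam 0 x) x := by
  rw [funext (fundamentalFunction_zero lam)]
  simpa [mul_comm] using ((hasDerivAt_id x).const_mul (lam 0)).cexp

lemma differentiable_fundamentalFunction (n : ℕ) : Differentiable ℂ (fundamentalFunction lam n)
  | x => match n with
    | 0 => (hasDerivAt_fundamentalFunction_zero lam x).differentiableAt
    | n + 1 => (hasDerivAt_fundamentalFunction_succ lam n x).differentiableAt

end FundamentalFunction

section Majorant

lemma norm_le_of_hasDerivAt_smul_add {E : Type*} [NormedAddCommGroup E] [NormedSpace ℂ E]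
    {f w : ℝ → E} {B ψ : ℝ → ℝ} {m : ℂ} {M T : ℝ} (hT : 0 ≤ T)
    (hf : ∀ t ∈ Icc 0 T, HasDerivAt f (m • f t + w t) t)
    (hB : ∀ t, HasDerivAt B (M * B t + ψ t) t) (hm : m.re ≤ M)
    (hw : ∀ t ∈ Ico 0 T, ‖w t‖ ≤ ψ t) (h0 : ‖f 0‖ ≤ B 0) : ‖f T‖ ≤ B T := by
  have hu : ∀ t ∈ Icc 0 T, HasDerivAt (fun t : ℝ => Complex.exp (m * (T - t)) • f t)
      (Complex.exp (m * (T - t)) • w t) t := by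
    intro t ht
    have hexp : HasDerivAt (fun t : ℝ => Complex.exp (m * (T - t)))
        (Complex.exp (m * (T - t)) * (m * -1)) t :=
      (((hasDerivAt_id (t : ℂ)).const_sub (T : ℂ)).const_mul m).cexp.comp_ofReal
    refine (hexp.smul (hf t ht)).congr_deriv ?_
    module
  have hb : ∀ t, HasDerivAt (fun t => Real.exp (M * (T - t)) * B t)
      (Real.exp (M * (T - t)) * ψ t) t := by
    intro t
    refine ((((hasDerivAt_id t).const_sub T).const_mul M).exp.mul (hB t)).congr_deriv ?_
    simp only [id_eq]
    ring
  have hexp : ∀ t ≤ T, ‖Complex.exp (m * (T - t))‖ ≤ Real.exp (M * (T - t)) := by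
    intro t ht
    rw [Complex.norm_exp, ← Complex.ofReal_sub, Complex.re_mul_ofReal]
    gcongr
  have key := image_norm_le_of_norm_deriv_right_le_deriv_boundary
    (fun t ht => (hu t ht).continuousAt.continuousWithinAt)
    (fun t ht => (hu t (Ico_subset_Icc_self ht)).hasDerivWithinAt)
    (by
      rw [norm_smul]
      have := hexp 0 hT
      gcongr) hb
    (fun t ht => by
      rw [norm_smul]
      have := hexp t ht.2.le
      have := hw t ht
      gcongr)
    (right_mem_Icc.2 hT)
  simpa using key

/-- The fundamental function of the exponents `b, b + 1, …, b + n`, in closed form, on the real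
line. -/
def expMajorant (b : ℝ) (n : ℕ) (r : ℝ) : ℝ :=
  Real.exp (b * r) * (Real.exp r - 1) ^ n / n.factorial

lemma hasDerivAt_expMajorant_succ (b : ℝ) (n : ℕ) (r : ℝ) :
    HasDerivAt (expMajorant b (n + 1))
      ((b + (n + 1 : ℕ)) * expMajorant b (n + 1) r + expMajorant b n r) r := by
  have hexp := ((hasDerivAt_id r).const_mul b).exp
  have hpow := ((hasDerivAt_id r).exp.sub_const 1).pow (n + 1)
  refine ((hexp.mul hpow).div_const ((n + 1).factorial : ℝ)).congr_deriv ?_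
  simp only [expMajorant, Nat.factorial_succ, Pi.pow_apply, id_eq, mul_one,
    add_tsub_cancel_right, pow_succ]
  push_cast
  field_simp
  ring

lemma norm_fundamentalFunction_le_expMajorant {lam : ℕ → ℂ} {b : ℝ} (hb : ∀ j, ‖lam j‖ ≤ b + j)
    (n : ℕ) (z : ℂ) : ‖fundamentalFunction lam n z‖ ≤ expMajorant b n ‖z‖ := by
  induction n generalizing z with
  | zero =>
    have hlam : ‖lam 0‖ ≤ b := by simpa using hb 0
    rw [fundamentalFunction_zero, Complex.norm_exp]
    simp only [expMajorant, pow_zero, mul_one, Nat.factorial_zero, Nat.cast_one, div_one]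
    gcongr
    exact (Complex.re_le_norm _).trans (by rw [norm_mul]; gcongr)
  | succ n ih =>
    have hf (t : ℝ) : HasDerivAt (fun t : ℝ => fundamentalFunction lam (n + 1) (t * z))
        ((lam (n + 1) * z) • fundamentalFunction lam (n + 1) (t * z) +
          z * fundamentalFunction lam n (t * z)) t := by
      refine (HasDerivAt.comp (h₂ := fundamentalFunction lam (n + 1)) (h := (· * z)) (t : ℂ)
        (hasDerivAt_fundamentalFunction_succ lam n (t * z))
        ((hasDerivAt_id (t : ℂ)).mul_const z)).comp_ofReal.congr_deriv ?_
      simp only [smul_eq_mul]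
      ring
    have hB (t : ℝ) : HasDerivAt (fun t => expMajorant b (n + 1) (t * ‖z‖))
        ((b + (n + 1 : ℕ)) * ‖z‖ * expMajorant b (n + 1) (t * ‖z‖) +
          ‖z‖ * expMajorant b n (t * ‖z‖)) t := by
      refine ((hasDerivAt_expMajorant_succ b n (t * ‖z‖)).comp t
        ((hasDerivAt_id t).mul_const ‖z‖)).congr_deriv ?_
      ring
    have hw : ∀ t ∈ Ico (0 : ℝ) 1, ‖z * fundamentalFunction lam n (t * z)‖ ≤
        ‖z‖ * expMajorant b n (t * ‖z‖) := by
      intro t ht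
      have := ih (t * z)
      rw [norm_mul (t : ℂ), Complex.norm_of_nonneg ht.1] at this
      rw [norm_mul]
      gcongr
    have hm : (lam (n + 1) * z).re ≤ (b + (n + 1 : ℕ)) * ‖z‖ :=
      (Complex.re_le_norm _).trans (by rw [norm_mul]; gcongr; exact hb (n + 1))
    simpa using norm_le_of_hasDerivAt_smul_add zero_le_one (fun t _ => hf t) hB hm hw
      (by simp [fundamentalFunction_succ_apply_zero, expMajorant])

end Majorant

section GenDeriv

variable {lam : ℕ → ℂ} {g h : ℝ → ℂ} {U : Set ℝ}

lemma genDeriv_eqOn (hU : IsOpen U) (hgh : EqOn g h U) (n : ℕ) :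
    EqOn (genDeriv lam n g) (genDeriv lam n h) U := by
  induction n with
  | zero => exact hgh
  | succ n ih =>
    intro v hv
    simp only [genDeriv]
    rw [(ih.eventuallyEq_of_mem (hU.mem_nhds hv)).deriv_eq, ih hv]

lemma genDeriv_add (lam : ℕ → ℂ) (g : ℝ → ℂ) (m n : ℕ) :
    genDeriv lam (m + n) g = genDeriv (fun j => lam (m + j)) n (genDeriv lam m g) := by
  induction n with
  | zero => rfl
  | succ n ih =>
    funext v
    rw [← Nat.add_assoc]
    simp only [genDeriv, ih]

lemma contDiffOn_genDeriv (hU : IsOpen U) (hg : ContDiffOn ℝ ∞ g U) (n : ℕ) :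
    ContDiffOn ℝ ∞ (genDeriv lam n g) U := by
  induction n with
  | zero => exact hg
  | succ n ih => exact (ih.deriv_of_isOpen hU (by simp)).sub (contDiffOn_const.mul ih)

lemma differentiableAt_genDeriv (hU : IsOpen U) (hg : ContDiffOn ℝ ∞ g U) (n : ℕ) {v : ℝ}
    (hv : v ∈ U) : DifferentiableAt ℝ (genDeriv lam n g) v :=
  ((contDiffOn_genDeriv hU hg n).contDiffAt (hU.mem_nhds hv)).differentiableAt (by simp)

lemma hasDerivAt_genDeriv {n : ℕ} {v : ℝ} (h : DifferentiableAt ℝ (genDeriv lam n g) v) :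
    HasDerivAt (genDeriv lam n g) (genDeriv lam (n + 1) g v + lam n * genDeriv lam n g v) v :=
  h.hasDerivAt.congr_deriv (sub_add_cancel _ _).symm

lemma genDeriv_exp_mul (hU : IsOpen U) (hg : ContDiffOn ℝ ∞ g U) (c : ℂ) (n : ℕ) :
    EqOn (genDeriv (fun j => lam j + c) n fun v => Complex.exp (c * v) * g v)
      (fun v => Complex.exp (c * v) * genDeriv lam n g v) U := by
  induction n with
  | zero => exact fun v _ => rfl
  | succ n ih =>
    intro v hv
    have hexp : HasDerivAt (fun v : ℝ => Complex.exp (c * v)) (Complex.exp (c * v) * c) v := by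
      simpa using (((hasDerivAt_id (v : ℂ)).const_mul c).cexp).comp_ofReal
    have hprod := hexp.fun_mul
      (hasDerivAt_genDeriv (lam := lam) (differentiableAt_genDeriv hU hg n hv))
    simp only [genDeriv]
    rw [(ih.eventuallyEq_of_mem (hU.mem_nhds hv)).deriv_eq, hprod.deriv, ih hv]
    simp only [genDeriv]
    ring

end GenDeriv

section GeneralizedTaylor

variable {lam : ℕ → ℂ} {g : ℝ → ℂ}

lemma hasDerivAt_comp_const_sub_ofReal {Φ : ℂ → ℂ} {Φ' w : ℂ} {s : ℝ}
    (h : HasDerivAt Φ Φ' (w - s)) : HasDerivAt (fun s : ℝ => Φ (w - s)) (-Φ') s := by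
  simpa using (HasDerivAt.comp (s : ℂ) h ((hasDerivAt_id (s : ℂ)).const_sub w)).comp_ofReal

/-- The terms produced by differentiating `D^(n) g` and `Φ_n` telescope. -/
lemma hasDerivAt_sum_genDeriv_mul (w : ℂ) (N : ℕ) {s : ℝ}
    (hg : ∀ n ≤ N, DifferentiableAt ℝ (genDeriv lam n g) s) :
    HasDerivAt (fun s : ℝ => ∑ n ∈ Finset.range (N + 1),
        genDeriv lam n g s * fundamentalFunction lam n (w - s))
      (genDeriv lam (N + 1) g s * fundamentalFunction lam N (w - s)) s := by
  induction N with
  | zero =>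
    simp only [zero_add, Finset.sum_range_one]
    refine ((hasDerivAt_genDeriv (hg 0 le_rfl)).mul (hasDerivAt_comp_const_sub_ofReal
      (hasDerivAt_fundamentalFunction_zero lam _))).congr_deriv ?_
    ring
  | succ N ih =>
    simp only [Finset.sum_range_succ _ (N + 1)]
    refine ((ih fun n hn => hg n (hn.trans N.le_succ)).add
      ((hasDerivAt_genDeriv (hg (N + 1) le_rfl)).mul (hasDerivAt_comp_const_sub_ofReal
        (hasDerivAt_fundamentalFunction_succ lam N _)))).congr_deriv ?_
    ring

lemma sum_taylorTerm_self (N : ℕ) (v : ℝ) :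
    ∑ n ∈ Finset.range (N + 1), taylorTerm lam g v n v = g v := by
  simp only [taylorTerm, Finset.sum_range_succ', sub_self, fundamentalFunction_succ_apply_zero,
    mul_zero, Finset.sum_const_zero, zero_add, fundamentalFunction_zero, Complex.exp_zero, mul_one,
    genDeriv]

lemma norm_sub_sum_taylorTerm_le {v₀ v C : ℝ} {N : ℕ}
    (hg : ∀ n ≤ N, ∀ t ∈ uIcc v₀ v, DifferentiableAt ℝ (genDeriv lam n g) t)
    (hC : ∀ t ∈ uIcc v₀ v,
      ‖genDeriv lam (N + 1) g t * fundamentalFunction lam N ((v : ℂ) - t)‖ ≤ C) :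
    ‖g v - ∑ n ∈ Finset.range (N + 1), taylorTerm lam g v₀ n v‖ ≤ C * |v - v₀| := by
  have mean_value := Convex.norm_image_sub_le_of_norm_hasDerivWithin_le
    (fun t ht => (hasDerivAt_sum_genDeriv_mul v N fun n hn => hg n hn t ht).hasDerivWithinAt)
    hC (convex_uIcc v₀ v) left_mem_uIcc right_mem_uIcc
  rw [← sum_taylorTerm_self (lam := lam) (g := g) N v]
  exact mean_value

end GeneralizedTaylor

section Convergence

variable {lam : ℕ → ℂ} {g : ℝ → ℂ} {τ : ℝ}

/-- The generalized derivatives `D^(n) g` grow on `S` like those of the radial coefficients of a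
polyharmonic function of type `τ`: for every `ρ > τ` they are `O(n! (e^t ρ)^n)`, uniformly in
`t ∈ S`. -/
def GenDerivGrowth (lam : ℕ → ℂ) (τ : ℝ) (g : ℝ → ℂ) (S : Set ℝ) : Prop :=
  ∀ ρ > τ, ∃ C ≥ 0, ∀ n, ∀ t ∈ S,
    ‖genDeriv lam n g t‖ ≤ C * n.factorial * (Real.exp t * ρ) ^ n

lemma GenDerivGrowth.mono {S T : Set ℝ} (h : GenDerivGrowth lam τ g T) (hST : S ⊆ T) :
    GenDerivGrowth lam τ g S := fun ρ hρ =>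
  let ⟨C, hC, hbound⟩ := h ρ hρ
  ⟨C, hC, fun n t ht => hbound n t (hST ht)⟩

lemma mem_convergenceDisc_iff (hτ : 0 ≤ τ) {v₀ : ℝ} {z : ℂ} :
    z ∈ convergenceDisc τ v₀ ↔ Real.exp v₀ * τ * (Real.exp ‖z - v₀‖ - 1) < 1 := by
  unfold convergenceDisc
  split_ifs with h
  · simp [h]
  · have hpos : 0 < Real.exp v₀ * τ := mul_pos (Real.exp_pos _) (hτ.lt_of_ne' h)
    rw [Metric.mem_ball, dist_eq_norm, Real.lt_log_iff_exp_lt (by positivity),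
      ← sub_lt_iff_lt_add', lt_div_iff₀ hpos, mul_comm]

lemma isOpen_convergenceDisc (τ v₀ : ℝ) : IsOpen (convergenceDisc τ v₀) := by
  unfold convergenceDisc
  split_ifs
  exacts [isOpen_univ, Metric.isOpen_ball]

lemma exists_gt_mul_mul_lt_one {A B : ℝ} (h : A * τ * B < 1) : ∃ ρ > τ, A * ρ * B < 1 := by
  have hlim : Tendsto (fun ρ : ℝ => A * ρ * B) (𝓝[>] τ) (𝓝 (A * τ * B)) :=
    (Continuous.tendsto (by fun_prop) τ).mono_left nhdsWithin_le_nhds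
  obtain ⟨ρ, hlt, hρ⟩ := ((hlim.eventually_lt_const h).and self_mem_nhdsWithin).exists
  exact ⟨ρ, hρ, hlt⟩

lemma expMajorant_le_expMajorant {b r R : ℝ} (hb : 0 ≤ b) (hr : 0 ≤ r) (hrR : r ≤ R) (n : ℕ) :
    expMajorant b n r ≤ expMajorant b n R := by
  have : 0 ≤ Real.exp r - 1 := sub_nonneg.2 (Real.one_le_exp hr)
  unfold expMajorant
  gcongr

variable {b : ℝ} (hb : ∀ j, ‖lam j‖ ≤ b + j)

include hb

lemma norm_taylorTerm_le {v₀ C ρ R : ℝ} {n : ℕ}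
    (hD : ‖genDeriv lam n g v₀‖ ≤ C * n.factorial * (Real.exp v₀ * ρ) ^ n) {z : ℂ}
    (hz : ‖z - v₀‖ ≤ R) :
    ‖taylorTerm lam g v₀ n z‖ ≤
      C * Real.exp (b * R) * (Real.exp v₀ * ρ * (Real.exp R - 1)) ^ n := by
  have hb₀ : 0 ≤ b := (norm_nonneg _).trans (by simpa using hb 0)
  calc ‖taylorTerm lam g v₀ n z‖
      ≤ (C * n.factorial * (Real.exp v₀ * ρ) ^ n) * expMajorant b n R := by
        rw [taylorTerm, norm_mul]
        gcongr
        · exact (norm_nonneg _).trans hD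
        · exact (norm_fundamentalFunction_le_expMajorant hb n _).trans
            (expMajorant_le_expMajorant hb₀ (norm_nonneg _) hz n)
    _ = C * Real.exp (b * R) * (Real.exp v₀ * ρ * (Real.exp R - 1)) ^ n := by
        rw [expMajorant, mul_pow _ (Real.exp R - 1)]
        field_simp

lemma GenDerivGrowth.exists_summable_bound {v₀ : ℝ} (hτ : 0 ≤ τ)
    (hD : GenDerivGrowth lam τ g {v₀}) {w : ℂ} (hw : w ∈ convergenceDisc τ v₀) :
    ∃ u : ℕ → ℝ, Summable u ∧
      ∀ n (z : ℂ), ‖z - v₀‖ ≤ ‖w - v₀‖ → ‖taylorTerm lam g v₀ n z‖ ≤ u n := by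
  obtain ⟨ρ, hρ, hlt⟩ := exists_gt_mul_mul_lt_one ((mem_convergenceDisc_iff hτ).1 hw)
  obtain ⟨C, -, hDC⟩ := hD ρ hρ
  refine ⟨_, ?_, fun n z hz => norm_taylorTerm_le hb (hDC n v₀ rfl) hz⟩
  have hρ₀ : 0 ≤ ρ := hτ.trans hρ.le
  have hexp : 0 ≤ Real.exp ‖w - v₀‖ - 1 := sub_nonneg.2 (Real.one_le_exp (norm_nonneg _))
  exact (summable_geometric_of_lt_one (by positivity) hlt).mul_left _

lemma GenDerivGrowth.summable_norm_taylorTerm {v₀ : ℝ} (hτ : 0 ≤ τ)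
    (hD : GenDerivGrowth lam τ g {v₀}) {z : ℂ} (hz : z ∈ convergenceDisc τ v₀) :
    Summable fun n => ‖taylorTerm lam g v₀ n z‖ := by
  obtain ⟨u, hu, hbound⟩ := hD.exists_summable_bound hb hτ hz
  exact .of_nonneg_of_le (fun _ => norm_nonneg _) (fun n => hbound n z le_rfl) hu

lemma GenDerivGrowth.tendstoUniformlyOn_taylorSeries {v₀ : ℝ} (hτ : 0 ≤ τ)
    (hD : GenDerivGrowth lam τ g {v₀}) {K : Set ℂ} (hK : K ⊆ convergenceDisc τ v₀)
    (hKc : IsCompact K) :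
    TendstoUniformlyOn (fun (N : ℕ) (z : ℂ) => ∑ n ∈ Finset.range N, taylorTerm lam g v₀ n z)
      (fun z => ∑' n, taylorTerm lam g v₀ n z) atTop K := by
  rcases K.eq_empty_or_nonempty with rfl | hne
  · exact tendstoUniformlyOn_empty
  obtain ⟨w, hw, hmax⟩ := hKc.exists_isMaxOn hne (f := fun z : ℂ => ‖z - v₀‖) (by fun_prop)
  obtain ⟨u, hu, hbound⟩ := hD.exists_summable_bound hb hτ (hK hw)
  exact tendstoUniformlyOn_tsum_nat hu fun n z hz => hbound n z (hmax hz)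

lemma GenDerivGrowth.analyticOnNhd_taylorSeries {v₀ : ℝ} (hτ : 0 ≤ τ)
    (hD : GenDerivGrowth lam τ g {v₀}) :
    AnalyticOnNhd ℂ (fun z => ∑' n, taylorTerm lam g v₀ n z) (convergenceDisc τ v₀) := by
  have hopen := isOpen_convergenceDisc τ v₀
  refine DifferentiableOn.analyticOnNhd ?_ hopen
  refine ((tendstoLocallyUniformlyOn_iff_forall_isCompact hopen).2 fun K hK hKc =>
    hD.tendstoUniformlyOn_taylorSeries hb hτ hK hKc).differentiableOn
    (.of_forall fun N => .fun_sum fun n _ => Differentiable.differentiableOn ?_) hopen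
  exact ((differentiable_fundamentalFunction lam n).comp
    (differentiable_id.sub_const (v₀ : ℂ))).const_mul _

omit hb in
lemma exp_mul_exp_abs_sub_one_le {v₀ v t : ℝ} (ht : t ∈ uIcc v₀ v) :
    Real.exp t * (Real.exp |v - t| - 1) ≤ Real.exp v₀ * (Real.exp |v - v₀| - 1) := by
  rcases le_total v₀ v with h | h
  · rw [uIcc_of_le h] at ht
    rw [abs_of_nonneg (sub_nonneg.2 ht.2), abs_of_nonneg (sub_nonneg.2 h), mul_sub, mul_sub,
      ← Real.exp_add, ← Real.exp_add, add_sub_cancel, add_sub_cancel]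
    linarith [Real.exp_le_exp.2 ht.1]
  · rw [uIcc_of_ge h] at ht
    rw [abs_of_nonpos (sub_nonpos.2 ht.1), abs_of_nonpos (sub_nonpos.2 h)]
    have hexp : 0 ≤ Real.exp (-(v - t)) - 1 :=
      sub_nonneg.2 (Real.one_le_exp (neg_nonneg.2 (sub_nonpos.2 ht.1)))
    gcongr
    exacts [ht.2, ht.2]

lemma norm_genDeriv_mul_fundamentalFunction_le {v₀ v t C ρ : ℝ} {N : ℕ} (hC : 0 ≤ C) (hρ : 0 ≤ ρ)
    (ht : t ∈ uIcc v₀ v)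
    (hD : ‖genDeriv lam (N + 1) g t‖ ≤ C * (N + 1).factorial * (Real.exp t * ρ) ^ (N + 1)) :
    ‖genDeriv lam (N + 1) g t * fundamentalFunction lam N ((v : ℂ) - t)‖ ≤
      C * (Real.exp (v₀ + |v - v₀|) * ρ) * Real.exp (b * |v - v₀|) *
        (((N : ℝ) + 1) * (Real.exp v₀ * ρ * (Real.exp |v - v₀| - 1)) ^ N) := by
  have hb₀ : 0 ≤ b := (norm_nonneg _).trans (by simpa using hb 0)
  have hdist : |v - t| ≤ |v - v₀| := abs_sub_right_of_mem_uIcc ht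
  have hexp : 0 ≤ Real.exp |v - t| - 1 := sub_nonneg.2 (Real.one_le_exp (abs_nonneg _))
  have ht' : t ≤ v₀ + |v - v₀| := by linarith [le_abs_self (t - v₀), abs_sub_left_of_mem_uIcc ht]
  have hΦ := norm_fundamentalFunction_le_expMajorant hb N ((v : ℂ) - t)
  rw [← Complex.ofReal_sub, Complex.norm_real, Real.norm_eq_abs] at hΦ
  have hrate : ρ * (Real.exp t * (Real.exp |v - t| - 1)) ≤
      ρ * (Real.exp v₀ * (Real.exp |v - v₀| - 1)) :=
    mul_le_mul_of_nonneg_left (exp_mul_exp_abs_sub_one_le ht) hρ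
  rw [norm_mul, ← Complex.ofReal_sub]
  calc _ ≤ (C * (N + 1).factorial * (Real.exp t * ρ) ^ (N + 1)) * expMajorant b N |v - t| := by
        gcongr
    _ = C * (Real.exp t * ρ) * Real.exp (b * |v - t|) *
          (((N : ℝ) + 1) * (ρ * (Real.exp t * (Real.exp |v - t| - 1))) ^ N) := by
        rw [expMajorant, Nat.factorial_succ, pow_succ, mul_pow, mul_pow, mul_pow]
        push_cast
        field_simp
    _ ≤ C * (Real.exp (v₀ + |v - v₀|) * ρ) * Real.exp (b * |v - v₀|) *
          (((N : ℝ) + 1) * (ρ * (Real.exp v₀ * (Real.exp |v - v₀| - 1))) ^ N) := by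
        gcongr ?_ * ?_ * ?_ * (_ * ?_)
        · gcongr
        · gcongr
        · exact pow_le_pow_left₀ (by positivity) hrate N
    _ = _ := by rw [mul_left_comm ρ, mul_assoc (Real.exp v₀) ρ]

omit hb in
lemma tendsto_add_one_mul_pow_of_lt_one {q : ℝ} (hq₀ : 0 ≤ q) (hq₁ : q < 1) :
    Tendsto (fun n : ℕ => ((n : ℝ) + 1) * q ^ n) atTop (𝓝 0) := by
  simpa [add_mul] using (tendsto_self_mul_const_pow_of_lt_one hq₀ hq₁).add
    (tendsto_pow_atTop_nhds_zero_of_lt_one hq₀ hq₁)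

lemma GenDerivGrowth.tsum_taylorTerm_eq {v₀ v : ℝ} (hτ : 0 ≤ τ)
    (hD : GenDerivGrowth lam τ g (uIcc v₀ v)) (hv : (v : ℂ) ∈ convergenceDisc τ v₀)
    (hg : ∀ n, ∀ t ∈ uIcc v₀ v, DifferentiableAt ℝ (genDeriv lam n g) t) :
    ∑' n, taylorTerm lam g v₀ n v = g v := by
  have hsum := ((hD.mono (singleton_subset_iff.2 left_mem_uIcc)).summable_norm_taylorTerm
    hb hτ hv).of_norm.hasSum.tendsto_sum_nat
  refine tendsto_nhds_unique hsum ((tendsto_add_atTop_iff_nat 1).1 ?_)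
  rw [mem_convergenceDisc_iff hτ, ← Complex.ofReal_sub, Complex.norm_real, Real.norm_eq_abs] at hv
  obtain ⟨ρ, hρ, hq₁⟩ := exists_gt_mul_mul_lt_one hv
  obtain ⟨C, hC, hbound⟩ := hD ρ hρ
  have hρ₀ : 0 ≤ ρ := hτ.trans hρ.le
  have hexp : 0 ≤ Real.exp |v - v₀| - 1 := sub_nonneg.2 (Real.one_le_exp (abs_nonneg _))
  have hremainder (N : ℕ) := norm_sub_sum_taylorTerm_le (fun n _ => hg n) fun t ht =>
    norm_genDeriv_mul_fundamentalFunction_le hb hC hρ₀ ht (hbound (N + 1) t ht)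
  have hlim := ((tendsto_add_one_mul_pow_of_lt_one (by positivity) hq₁).const_mul
    (C * (Real.exp (v₀ + |v - v₀|) * ρ) * Real.exp (b * |v - v₀|))).mul_const |v - v₀|
  rw [mul_zero, zero_mul] at hlim
  rw [tendsto_iff_norm_sub_tendsto_zero]
  refine squeeze_zero (fun _ => norm_nonneg _) (fun N => ?_) hlim
  rw [norm_sub_rev]
  exact hremainder N

end Convergence

section Interpolation

lemma exists_fundamentalFunction_one_ne_zero (lam : ℕ → ℂ) {η : ℝ} (hη : 0 < η) :
    ∃ δ ∈ Ioo 0 η, fundamentalFunction lam 1 δ ≠ 0 := by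
  have hderiv := (hasDerivAt_fundamentalFunction_succ lam 0 ((0 : ℝ) : ℂ)).comp_ofReal
  have hne : ∀ᶠ x : ℝ in 𝓝[>] 0, fundamentalFunction lam 1 x ≠ 0 :=
    (hderiv.eventually_ne (c := 0) (by
      simp [fundamentalFunction_succ_apply_zero, fundamentalFunction_zero])).filter_mono
      (nhdsWithin_mono _ fun _ hx => (mem_Ioi.1 hx).ne')
  obtain ⟨δ, hδΦ, hδ⟩ := (hne.and (Ioo_mem_nhdsGT hη)).exists
  exact ⟨δ, hδ, hδΦ⟩

/-- The Taylor formula of order one on `[v, v + δ]`, solved for `D^(1) g v`. -/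
lemma exists_norm_genDeriv_one_le (lam : ℕ → ℂ) {η : ℝ} (hη : 0 < η) :
    ∃ δ ∈ Ioo 0 η, ∃ C ≥ 0, ∀ {g : ℝ → ℂ} {v X Z : ℝ},
      (∀ n ≤ 1, ∀ t ∈ Icc v (v + δ), DifferentiableAt ℝ (genDeriv lam n g) t) →
      (∀ t ∈ Icc v (v + δ), ‖g t‖ ≤ X) →
      (∀ t ∈ Icc v (v + δ), ‖genDeriv lam 2 g t‖ ≤ Z) →
      ‖genDeriv lam 1 g v‖ ≤ C * (X + Z) := by
  obtain ⟨δ, hδ, hΦ⟩ := exists_fundamentalFunction_one_ne_zero lam hη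
  obtain ⟨m, hm⟩ := (isCompact_closedBall (0 : ℂ) δ).exists_bound_of_continuousOn
    (differentiable_fundamentalFunction lam 1).continuous.continuousOn
  have hδ₀ : 0 ≤ δ := hδ.1.le
  have hm₀ : 0 ≤ m := (norm_nonneg _).trans (hm 0 (Metric.mem_closedBall_self hδ₀))
  refine ⟨δ, hδ, (1 + ‖fundamentalFunction lam 0 δ‖ + m * δ) / ‖fundamentalFunction lam 1 δ‖,
    by positivity, fun {g v X Z} hg hX hZ => ?_⟩
  have hvδ : v ≤ v + δ := le_add_of_nonneg_right hδ₀
  have hX₀ : 0 ≤ X := (norm_nonneg _).trans (hX v (left_mem_Icc.2 hvδ))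
  have hZ₀ : 0 ≤ Z := (norm_nonneg _).trans (hZ v (left_mem_Icc.2 hvδ))
  rw [← uIcc_of_le hvδ] at hg hX hZ
  have hremainder : ‖g (v + δ) - ∑ n ∈ Finset.range 2, taylorTerm lam g v n (v + δ : ℝ)‖ ≤
      Z * m * |v + δ - v| := by
    refine norm_sub_sum_taylorTerm_le hg fun t ht => ?_
    rw [norm_mul]
    refine mul_le_mul (hZ t ht) (hm _ ?_) (norm_nonneg _) hZ₀
    rw [mem_closedBall_zero_iff, ← Complex.ofReal_sub, Complex.norm_real, Real.norm_eq_abs]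
    simpa [abs_of_nonneg hδ₀] using abs_sub_right_of_mem_uIcc ht
  simp only [Finset.sum_range_succ, Finset.sum_range_zero, zero_add, taylorTerm,
    ← Complex.ofReal_sub, add_sub_cancel_left, abs_of_nonneg hδ₀] at hremainder
  have hzero : genDeriv lam 0 g v = g v := rfl
  rw [hzero] at hremainder
  rw [div_mul_eq_mul_div, le_div_iff₀ (norm_pos_iff.2 hΦ), ← norm_mul]
  calc ‖genDeriv lam 1 g v * fundamentalFunction lam 1 δ‖
      ≤ ‖g (v + δ)‖ + ‖g v * fundamentalFunction lam 0 δ‖ + Z * m * δ := by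
        refine le_trans (Eq.le ?_) ((norm_sub_le _ _).trans
          (add_le_add (norm_sub_le _ _) hremainder))
        congr 1
        ring
    _ ≤ X + X * ‖fundamentalFunction lam 0 δ‖ + Z * m * δ := by
        rw [norm_mul]
        gcongr
        exacts [hX _ right_mem_uIcc, hX _ left_mem_uIcc]
    _ ≤ (1 + ‖fundamentalFunction lam 0 δ‖ + m * δ) * (X + Z) := by
        have hnonneg : 0 ≤ Z * (1 + ‖fundamentalFunction lam 0 δ‖) + m * δ * X := by positivity
        linarith

end Interpolation

section EvenGrowth

variable {lam : ℕ → ℂ} {g : ℝ → ℂ} {τ : ℝ} {U : Set ℝ}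

lemma genDeriv_exp_mul_genDeriv_two_mul (hlam : ∀ n, lam (n + 2) = lam n + 2) (hU : IsOpen U)
    (hg : ContDiffOn ℝ ∞ g U) (p n : ℕ) {v : ℝ} (hv : v ∈ U) :
    genDeriv lam n (fun v => Complex.exp (-(2 * p) * v) * genDeriv lam (2 * p) g v) v =
      Complex.exp (-(2 * p) * v) * genDeriv lam (2 * p + n) g v := by
  have hshift : (fun j => lam (2 * p + j) + -(2 * (p : ℂ))) = lam := by
    funext j
    induction p with
    | zero => simp
    | succ p ih =>
      rw [show 2 * (p + 1) + j = 2 * p + j + 2 by ring, hlam, ← ih]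
      push_cast
      ring
  have hconj := genDeriv_exp_mul (lam := fun j => lam (2 * p + j)) hU
    (contDiffOn_genDeriv (lam := lam) hU hg (2 * p)) (-(2 * (p : ℂ))) n
  rw [hshift, ← genDeriv_add] at hconj
  exact hconj hv

lemma norm_exp_neg_two_mul_mul (p : ℕ) (t : ℝ) :
    ‖Complex.exp (-(2 * p) * t)‖ = (Real.exp t ^ (2 * p))⁻¹ := by
  rw [Complex.norm_exp, ← Real.exp_nat_mul, ← Real.exp_neg]
  simp

lemma exists_factorial_mul_pow_add_le {σ ρ : ℝ} (hσ : 0 < σ) (hσρ : σ < ρ) :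
    ∃ B ≥ 0, ∀ n : ℕ, n.factorial * σ ^ n + (n + 2).factorial * σ ^ (n + 2) ≤
      B * ((n + 1).factorial * ρ ^ (n + 1)) := by
  have hρ : 0 < ρ := hσ.trans hσρ
  have hq₀ : 0 ≤ σ / ρ := by positivity
  have hq₁ : σ / ρ < 1 := (div_lt_one hρ).2 hσρ
  have hlim : Tendsto (fun n : ℕ => (1 + ((n : ℝ) + 2) * σ ^ 2) * (σ / ρ) ^ n) atTop (𝓝 0) := by
    have hsum := ((tendsto_add_one_mul_pow_of_lt_one hq₀ hq₁).const_mul (σ ^ 2)).add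
      ((tendsto_pow_atTop_nhds_zero_of_lt_one hq₀ hq₁).const_mul (1 + σ ^ 2))
    rw [mul_zero, mul_zero, add_zero] at hsum
    exact hsum.congr fun n => by ring
  obtain ⟨M, hM⟩ := hlim.bddAbove_range
  have hbound (n : ℕ) : (1 + ((n : ℝ) + 2) * σ ^ 2) * (σ / ρ) ^ n ≤ M := hM ⟨n, rfl⟩
  have hM₀ : 0 ≤ M := le_trans (by positivity) (hbound 0)
  refine ⟨M / ρ, by positivity, fun n => ?_⟩
  calc (n.factorial : ℝ) * σ ^ n + (n + 2).factorial * σ ^ (n + 2)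
      ≤ (n + 1).factorial * σ ^ n + (n + 2).factorial * σ ^ (n + 2) := by
        gcongr
        exact n.le_succ
    _ = (n + 1).factorial * ρ ^ n * ((1 + ((n : ℝ) + 2) * σ ^ 2) * (σ / ρ) ^ n) := by
        rw [Nat.factorial_succ (n + 1), pow_add, div_pow]
        push_cast
        field_simp
        ring
    _ ≤ (n + 1).factorial * ρ ^ n * M := by
        gcongr
        exact hbound n
    _ = M / ρ * ((n + 1).factorial * ρ ^ (n + 1)) := by
        rw [pow_succ]
        field_simp

variable (hlam : ∀ n, lam (n + 2) = lam n + 2) (hU : IsOpen U) (hg : ContDiffOn ℝ ∞ g U)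
  (heven : ∀ K ⊆ U, IsCompact K → ∀ ρ > τ, ∃ C ≥ 0, ∀ p, ∀ t ∈ K,
    ‖genDeriv lam (2 * p) g t‖ ≤ C * (2 * p).factorial * (Real.exp t * ρ) ^ (2 * p))

include hlam hU hg heven

lemma exists_norm_genDeriv_two_mul_add_one_le (hτ : 0 ≤ τ) {K : Set ℝ} (hKU : K ⊆ U)
    (hK : IsCompact K) {σ : ℝ} (hσ : τ < σ) :
    ∃ C ≥ 0, ∀ p : ℕ, ∀ v ∈ K, ‖Complex.exp (-(2 * p) * v) * genDeriv lam (2 * p + 1) g v‖ ≤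
      C * ((2 * p).factorial * σ ^ (2 * p) + (2 * p + 2).factorial * σ ^ (2 * p + 2)) := by
  obtain ⟨η, hη, hηU⟩ := hK.exists_cthickening_subset_open hU hKU
  obtain ⟨δ, hδ, C₁, hC₁, hinterp⟩ := exists_norm_genDeriv_one_le lam hη
  obtain ⟨C₀, hC₀, hbound⟩ := heven _ hηU hK.cthickening σ hσ
  obtain ⟨M, hM⟩ := hK.cthickening (r := η) |>.exists_bound_of_continuousOn
    Real.continuous_exp.continuousOn
  have hσ₀ : 0 ≤ σ := hτ.trans hσ.le
  refine ⟨C₁ * (C₀ * (1 + M ^ 2)), by positivity, fun p v hv => ?_⟩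
  have hIcc : Icc v (v + δ) ⊆ Metric.cthickening η K := fun t ht =>
    Metric.mem_cthickening_of_dist_le t v η K hv (by
      rw [Real.dist_eq, abs_of_nonneg (sub_nonneg.2 ht.1)]
      linarith [ht.2, hδ.2])
  have hsmooth : ContDiffOn ℝ ∞
      (fun v : ℝ => Complex.exp (-(2 * p) * v) * genDeriv lam (2 * p) g v) U :=
    ContDiffOn.mul (contDiff_const.mul Complex.ofRealCLM.contDiff).cexp.contDiffOn
      (contDiffOn_genDeriv hU hg _)
  rw [← genDeriv_exp_mul_genDeriv_two_mul hlam hU hg p 1 (hKU hv), mul_assoc C₁]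
  refine (hinterp (X := C₀ * ((2 * p).factorial * σ ^ (2 * p)))
    (Z := C₀ * M ^ 2 * ((2 * p + 2).factorial * σ ^ (2 * p + 2)))
    (fun n _ t ht => differentiableAt_genDeriv hU hsmooth n (hηU (hIcc ht)))
    (fun t ht => ?_) fun t ht => ?_).trans ?_
  · rw [norm_mul, norm_exp_neg_two_mul_mul, inv_mul_le_iff₀ (by positivity)]
    exact (hbound p t (hIcc ht)).trans_eq (by ring)
  · rw [genDeriv_exp_mul_genDeriv_two_mul hlam hU hg p 2 (hηU (hIcc ht)), norm_mul,
      norm_exp_neg_two_mul_mul, inv_mul_le_iff₀ (by positivity)]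
    have hexp : Real.exp t ≤ M := (le_abs_self _).trans (hM t (hIcc ht))
    calc _ ≤ C₀ * (2 * p + 2).factorial * (Real.exp t * σ) ^ (2 * p + 2) :=
          hbound (p + 1) t (hIcc ht)
      _ = Real.exp t ^ (2 * p) *
          (C₀ * Real.exp t ^ 2 * ((2 * p + 2).factorial * σ ^ (2 * p + 2))) := by ring
      _ ≤ _ := by gcongr
  · gcongr
    have : 0 ≤ C₀ * M ^ 2 * ((2 * p).factorial * σ ^ (2 * p)) +
      C₀ * ((2 * p + 2).factorial * σ ^ (2 * p + 2)) := by positivity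
    linarith

lemma genDerivGrowth_of_even (hτ : 0 ≤ τ) {K : Set ℝ} (hKU : K ⊆ U) (hK : IsCompact K) :
    GenDerivGrowth lam τ g K := by
  intro ρ hρ
  obtain ⟨σ, hτσ, hσρ⟩ := exists_between hρ
  have hσ₀ : 0 < σ := hτ.trans_lt hτσ
  have hρ₀ : 0 < ρ := hσ₀.trans hσρ
  obtain ⟨C₀, hC₀, hbound₀⟩ := heven K hKU hK ρ hρ
  obtain ⟨C₁, hC₁, hbound₁⟩ :=
    exists_norm_genDeriv_two_mul_add_one_le hlam hU hg heven hτ hKU hK hτσ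
  obtain ⟨B, hB, hfactorial⟩ := exists_factorial_mul_pow_add_le hσ₀ hσρ
  obtain ⟨M, hM⟩ := hK.exists_bound_of_continuousOn (f := fun t => (Real.exp t)⁻¹)
    (Real.continuous_exp.inv₀ fun t => (Real.exp_pos t).ne').continuousOn
  refine ⟨max C₀ (C₁ * B * M), le_max_of_le_left hC₀, fun n v hv => ?_⟩
  obtain ⟨p, rfl | rfl⟩ := n.even_or_odd'
  · refine (hbound₀ p v hv).trans ?_
    gcongr
    exact le_max_left _ _
  · have hodd := (hbound₁ p v hv).trans (mul_le_mul_of_nonneg_left (hfactorial (2 * p)) hC₁)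
    rw [norm_mul, norm_exp_neg_two_mul_mul, inv_mul_le_iff₀ (by positivity)] at hodd
    calc _ ≤ C₁ * B * (Real.exp v)⁻¹ * (2 * p + 1).factorial * (Real.exp v * ρ) ^ (2 * p + 1) := by
          refine hodd.trans_eq ?_
          rw [mul_pow, pow_succ (Real.exp v)]
          field_simp
      _ ≤ _ := by
          gcongr
          refine le_trans ?_ (le_max_right _ _)
          gcongr
          exact (le_abs_self _).trans (hM v hv)

end EvenGrowth

section VecDeriv

variable {E F : Type*} [NormedAddCommGroup E] [NormedSpace ℝ E] [NormedAddCommGroup F]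
  [NormedSpace ℝ F] {h : E → F} {G : Set E} {x : E}

/-- The derivative of `h` along the linear vector field `x ↦ A x`. -/
def vecDeriv (A : E →L[ℝ] E) (h : E → F) (x : E) : F := fderiv ℝ h x (A x)

lemma vecDeriv_mul {𝔸 : Type*} [NormedCommRing 𝔸] [NormedAlgebra ℝ 𝔸] {A : E →L[ℝ] E}
    {h y : E → 𝔸} (hh : DifferentiableAt ℝ h x) (hy : DifferentiableAt ℝ y x) :
    vecDeriv A (fun x => h x * y x) x = vecDeriv A h x * y x + h x * vecDeriv A y x := by
  simp only [vecDeriv, fderiv_fun_mul hh hy, add_apply, smul_apply, smul_eq_mul]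
  ring

lemma vecDeriv_comp_smul (A : E →L[ℝ] E) (h : E → F) (r : ℝ) (x : E) :
    vecDeriv A (fun x => h (r • x)) x = vecDeriv A h (r • x) := by
  simp only [vecDeriv, fderiv_comp_smul, smul_apply, map_smul]

lemma contDiffOn_vecDeriv (A : E →L[ℝ] E) (hG : IsOpen G) {m n : ℕ∞ω} (hmn : m + 1 ≤ n)
    (hh : ContDiffOn ℝ n h G) : ContDiffOn ℝ m (vecDeriv A h) G :=
  (hh.fderiv_of_isOpen hG hmn).clm_apply A.contDiff.contDiffOn

lemma vecDeriv_vecDeriv (A : E →L[ℝ] E) (hh : ContDiffAt ℝ 2 h x) :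
    vecDeriv A (vecDeriv A h) x =
      fderiv ℝ (fderiv ℝ h) x (A x) (A x) + fderiv ℝ h x (A (A x)) := by
  have hd : HasFDerivAt (fderiv ℝ h) (fderiv ℝ (fderiv ℝ h) x) x :=
    ((hh.fderiv_right (m := 1) (by norm_num)).differentiableAt one_ne_zero).hasFDerivAt
  change fderiv ℝ (fun x => fderiv ℝ h x (A x)) x (A x) = _
  rw [(hd.clm_apply A.hasFDerivAt).fderiv]
  simp [add_comm]

end VecDeriv

section Sphere

open scoped Pointwise

variable {E F : Type*} [NormedAddCommGroup E] [InnerProductSpace ℝ E] [NormedAddCommGroup F]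
  [NormedSpace ℝ F]

/-- The homeomorphism of the unit sphere induced by a linear isometry. -/
def sphereHomeomorph (e : E ≃ₗᵢ[ℝ] E) : Metric.sphere (0 : E) 1 ≃ₜ Metric.sphere (0 : E) 1 where
  toFun θ := ⟨e θ, by simp⟩
  invFun θ := ⟨e.symm θ, by simp⟩
  left_inv θ := by simp
  right_inv θ := by simp
  continuous_toFun := by fun_prop
  continuous_invFun := by fun_prop

variable [FiniteDimensional ℝ E] [MeasurableSpace E] [BorelSpace E]

lemma measurePreserving_sphereHomeomorph (e : E ≃ₗᵢ[ℝ] E) :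
    MeasurePreserving (sphereHomeomorph e).toMeasurableEquiv
      (volume : Measure E).toSphere (volume : Measure E).toSphere := by
  refine ⟨(sphereHomeomorph e).toMeasurableEquiv.measurable, ?_⟩
  ext s hs
  have hs' : MeasurableSet (sphereHomeomorph e ⁻¹' s) :=
    (sphereHomeomorph e).toMeasurableEquiv.measurable hs
  have himage : e '' (Subtype.val '' (sphereHomeomorph e ⁻¹' s)) = Subtype.val '' s := by
    rw [image_image, ← (sphereHomeomorph e).surjective.image_preimage s, image_image,
      (sphereHomeomorph e).surjective.image_preimage]
    rfl
  have hcone : e '' (Ioo (0 : ℝ) 1 • Subtype.val '' (sphereHomeomorph e ⁻¹' s)) =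
      Ioo (0 : ℝ) 1 • Subtype.val '' s := by
    rw [← himage, ← iUnion_smul_set, ← iUnion_smul_set]
    simp only [image_iUnion, image_smul_comm, map_smul, implies_true]
  have hvolume := e.measurePreserving.measure_preimage_emb e.toHomeomorph.measurableEmbedding
    (e '' (Ioo (0 : ℝ) 1 • Subtype.val '' (sphereHomeomorph e ⁻¹' s)))
  rw [e.injective.preimage_image, hcone] at hvolume
  rw [MeasurableEquiv.map_apply, Measure.toSphere_apply' _ hs, Homeomorph.toMeasurableEquiv_coe,
    Measure.toSphere_apply' _ hs', hvolume]

lemma integral_sphere_comp_linearIsometryEquiv (e : E ≃ₗᵢ[ℝ] E) (φ : E → F) :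
    ∫ θ : Metric.sphere (0 : E) 1, φ (e θ) ∂(volume : Measure E).toSphere =
      ∫ θ : Metric.sphere (0 : E) 1, φ θ ∂(volume : Measure E).toSphere :=
  (measurePreserving_sphereHomeomorph e).integral_comp' fun θ : Metric.sphere (0 : E) 1 => φ θ

lemma hasDerivAt_integral_sphere_comp_exp (A : E →L[ℝ] E) {G : Set E} (hG : IsOpen G)
    (hA : ∀ t : ℝ, ∀ θ ∈ Metric.sphere (0 : E) 1, NormedSpace.exp (t • A) θ ∈ G) {φ : E → F}
    (hφ : ContDiffOn ℝ 1 φ G) :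
    HasDerivAt (fun t : ℝ => ∫ θ : Metric.sphere (0 : E) 1, φ (NormedSpace.exp (t • A) θ)
        ∂(volume : Measure E).toSphere)
      (∫ θ : Metric.sphere (0 : E) 1, vecDeriv A φ θ ∂(volume : Measure E).toSphere) 0 := by
  have hexp : Continuous fun t : ℝ => NormedSpace.exp (t • A) :=
    continuous_iff_continuousAt.2 fun t => (hasDerivAt_exp_smul_const (𝕂 := ℝ) A t).continuousAt
  have hflow : Continuous fun p : ℝ × Metric.sphere (0 : E) 1 =>
      NormedSpace.exp (p.1 • A) (p.2 : E) :=
    (hexp.comp continuous_fst).clm_apply (continuous_subtype_val.comp continuous_snd)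
  have hfield : Continuous fun p : ℝ × Metric.sphere (0 : E) 1 =>
      (NormedSpace.exp (p.1 • A) * A) (p.2 : E) :=
    ((hexp.comp continuous_fst).mul continuous_const).clm_apply
      (continuous_subtype_val.comp continuous_snd)
  have hmem : ∀ t (θ : Metric.sphere (0 : E) 1), NormedSpace.exp (t • A) (θ : E) ∈ G :=
    fun t θ => hA t θ θ.2
  have hderiv := hasDerivAt_setIntegral_of_isCompact (μ := (volume : Measure E).toSphere)
    (F := fun t θ => φ (NormedSpace.exp (t • A) (θ : E)))
    (F' := fun t θ => fderiv ℝ φ (NormedSpace.exp (t • A) (θ : E))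
      ((NormedSpace.exp (t • A) * A) (θ : E))) isCompact_univ .univ
    (univ_mem (f := 𝓝 (0 : ℝ)))
    (fun t _ => (hφ.continuousOn.comp_continuous (by fun_prop) (hmem t)).continuousOn)
    (((hφ.continuousOn_fderiv_of_isOpen hG le_rfl).comp_continuous hflow
      fun p => hmem p.1 p.2).clm_apply hfield).continuousOn
    fun t _ θ _ => by
      have hφt := ((hφ.differentiableOn one_ne_zero).differentiableAt
        (hG.mem_nhds (hmem t θ))).hasFDerivAt
      simpa [Function.comp_def] using hφt.comp_hasDerivAt t
        ((hasDerivAt_exp_smul_const (𝕂 := ℝ) A t).clm_apply (hasDerivAt_const t (θ : E)))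
  simpa [vecDeriv] using hderiv

lemma integral_sphere_vecDeriv_eq_zero {A : E →L[ℝ] E} (hA : A ∈ skewAdjoint (E →L[ℝ] E))
    {G : Set E} (hG : IsOpen G) (hS : Metric.sphere (0 : E) 1 ⊆ G) {φ : E → F}
    (hφ : ContDiffOn ℝ 1 φ G) :
    ∫ θ : Metric.sphere (0 : E) 1, vecDeriv A φ θ ∂(volume : Measure E).toSphere = 0 := by
  have hunitary : ∀ t : ℝ, NormedSpace.exp (t • A) ∈ unitary (E →L[ℝ] E) := fun t => by
    let _ : NormedAlgebra ℚ (E →L[ℝ] E) := NormedAlgebra.restrictScalars ℚ ℝ _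
    exact NormedSpace.exp_mem_unitary_of_mem_skewAdjoint (skewAdjoint.smul_mem t hA)
  let e : ℝ → E ≃ₗᵢ[ℝ] E := fun t => Unitary.linearIsometryEquiv ⟨_, hunitary t⟩
  have hderiv := hasDerivAt_integral_sphere_comp_exp A hG
    (fun t θ hθ => hS (mem_sphere_zero_iff_norm.2
      (((e t).norm_map θ).trans (mem_sphere_zero_iff_norm.1 hθ)))) hφ
  have hconst : ∀ t : ℝ, ∫ θ : Metric.sphere (0 : E) 1, φ (NormedSpace.exp (t • A) θ)
      ∂(volume : Measure E).toSphere =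
      ∫ θ : Metric.sphere (0 : E) 1, φ θ ∂(volume : Measure E).toSphere :=
    fun t => integral_sphere_comp_linearIsometryEquiv (e t) φ
  simp only [hconst] at hderiv
  exact hderiv.unique (hasDerivAt_const _ _)

lemma integrable_sphere_smul_mul {𝔸 : Type*} [NormedRing 𝔸] {G : Set E} {r : ℝ}
    (hS : ∀ θ ∈ Metric.sphere (0 : E) 1, r • θ ∈ G) {h y : E → 𝔸} (hh : ContinuousOn h G)
    (hy : Continuous y) :
    Integrable (fun θ : Metric.sphere (0 : E) 1 => h (r • (θ : E)) * y θ)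
      (volume : Measure E).toSphere :=
  ((hh.comp_continuous (by fun_prop) fun θ : Metric.sphere (0 : E) 1 => hS θ θ.2).mul
    (hy.comp continuous_subtype_val)).integrable_of_hasCompactSupport
      (HasCompactSupport.of_compactSpace _)

variable {𝔸 : Type*} [NormedCommRing 𝔸] [NormedAlgebra ℝ 𝔸]

lemma integral_sphere_vecDeriv_mul {A : E →L[ℝ] E} (hA : A ∈ skewAdjoint (E →L[ℝ] E))
    {G : Set E} (hG : IsOpen G) {r : ℝ} (hS : ∀ θ ∈ Metric.sphere (0 : E) 1, r • θ ∈ G)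
    {h y : E → 𝔸} (hh : ContDiffOn ℝ 1 h G) (hy : ContDiff ℝ 1 y) :
    ∫ θ : Metric.sphere (0 : E) 1, vecDeriv A h (r • (θ : E)) * y θ
        ∂(volume : Measure E).toSphere =
      -∫ θ : Metric.sphere (0 : E) 1, h (r • (θ : E)) * vecDeriv A y θ
        ∂(volume : Measure E).toSphere := by
  have hG' : IsOpen ((fun x : E => r • x) ⁻¹' G) := hG.preimage (continuous_const_smul r)
  have hhr : ContDiffOn ℝ 1 (fun x => h (r • x)) ((fun x : E => r • x) ⁻¹' G) :=
    hh.comp (contDiff_const_smul r).contDiffOn fun _ hx => hx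
  have hzero := integral_sphere_vecDeriv_eq_zero hA hG' hS (hhr.mul hy.contDiffOn)
  have hvh : ContinuousOn (vecDeriv A h) G :=
    (contDiffOn_vecDeriv A hG (zero_add _).le hh).continuousOn
  have hvy : Continuous (vecDeriv A y) := (hy.continuous_fderiv one_ne_zero).clm_apply A.continuous
  rw [← add_eq_zero_iff_eq_neg, ← integral_add (integrable_sphere_smul_mul hS hvh hy.continuous)
    (integrable_sphere_smul_mul hS hh.continuousOn hvy), ← hzero]
  refine integral_congr_ae (Eventually.of_forall fun θ => ?_)
  have hd : DifferentiableAt ℝ (fun x => h (r • x)) (θ : E) :=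
    (hhr.differentiableOn one_ne_zero).differentiableAt (hG'.mem_nhds (hS θ θ.2))
  simp only [vecDeriv_mul hd (hy.differentiable one_ne_zero _), vecDeriv_comp_smul]

end Sphere

section SphericalLaplacian

open scoped InnerProductSpace

variable {E F : Type*} [NormedAddCommGroup E] [InnerProductSpace ℝ E] [NormedAddCommGroup F]
  [NormedSpace ℝ F]

/-- The generator `x ↦ ⟪u, x⟫ v - ⟪v, x⟫ u` of the rotations in the plane spanned by `u` and `v`. -/
def rotationGenerator (u v : E) : E →L[ℝ] E :=
  (innerSL ℝ u).smulRight v - (innerSL ℝ v).smulRight u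

lemma rotationGenerator_apply (u v x : E) :
    rotationGenerator u v x = ⟪u, x⟫_ℝ • v - ⟪v, x⟫_ℝ • u := rfl

lemma rotationGenerator_mem_skewAdjoint [CompleteSpace E] (u v : E) :
    rotationGenerator u v ∈ skewAdjoint (E →L[ℝ] E) := by
  rw [skewAdjoint.mem_iff, ContinuousLinearMap.star_eq_adjoint, eq_comm,
    ContinuousLinearMap.eq_adjoint_iff]
  intro x y
  simp only [neg_apply, rotationGenerator_apply, inner_neg_left, inner_sub_left, inner_sub_right,
    real_inner_smul_left, real_inner_smul_right, real_inner_comm x]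
  ring

section OrthonormalBasis

variable {ι : Type*} [Fintype ι] (b : OrthonormalBasis ι ℝ E)

lemma sum_rotationGenerator_rotationGenerator (x : E) :
    ∑ i, ∑ j, rotationGenerator (b i) (b j) (rotationGenerator (b i) (b j) x) =
      (2 - 2 * (Fintype.card ι : ℝ)) • x := by
  classical
  have hij : ∀ i j, rotationGenerator (b i) (b j) (rotationGenerator (b i) (b j) x) =
      (if i = j then (2 : ℝ) • ⟪b i, x⟫_ℝ • b i else 0) - ⟪b i, x⟫_ℝ • b i -
        ⟪b j, x⟫_ℝ • b j := by
    intro i j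
    simp only [rotationGenerator_apply, inner_sub_right, real_inner_smul_right,
      b.inner_eq_ite, if_true]
    rcases eq_or_ne i j with rfl | hne
    · simp only [if_true]
      module
    · simp only [hne, hne.symm, if_false]
      module
  simp only [hij, Finset.sum_sub_distrib, Finset.sum_ite_eq, Finset.mem_univ, if_true,
    Finset.sum_const, Finset.card_univ]
  simp only [← Finset.smul_sum, b.sum_repr']
  module

lemma sum_apply_rotationGenerator_rotationGenerator (B : E →L[ℝ] E →L[ℝ] F) (x : E) :
    ∑ i, ∑ j, B (rotationGenerator (b i) (b j) x) (rotationGenerator (b i) (b j) x) =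
      (2 * ‖x‖ ^ 2) • ∑ i, B (b i) (b i) - (2 : ℝ) • B x x := by
  have hB : B x x = ∑ i, ∑ j, (⟪b j, x⟫_ℝ * ⟪b i, x⟫_ℝ) • B (b i) (b j) := by
    conv_lhs => rw [← b.sum_repr' x]
    simp only [map_sum, map_smul, _root_.sum_apply, smul_apply, Finset.smul_sum, mul_smul]
    exact Finset.sum_comm
  have hnorm : ‖x‖ ^ 2 = ∑ i, ⟪b i, x⟫_ℝ ^ 2 := by
    simpa using (b.sum_sq_norm_inner_right x).symm
  have hij : ∀ i j, B (rotationGenerator (b i) (b j) x) (rotationGenerator (b i) (b j) x) =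
      ⟪b i, x⟫_ℝ ^ 2 • B (b j) (b j) + ⟪b j, x⟫_ℝ ^ 2 • B (b i) (b i) -
        (⟪b j, x⟫_ℝ * ⟪b i, x⟫_ℝ) • B (b i) (b j) -
        (⟪b i, x⟫_ℝ * ⟪b j, x⟫_ℝ) • B (b j) (b i) := by
    intro i j
    simp only [rotationGenerator_apply, map_sub, map_smul, sub_apply, smul_apply]
    module
  simp only [hij, Finset.sum_sub_distrib, Finset.sum_add_distrib]
  rw [Finset.sum_comm (f := fun i j => ⟪b j, x⟫_ℝ ^ 2 • B (b i) (b i)),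
    Finset.sum_comm (f := fun i j => (⟪b i, x⟫_ℝ * ⟪b j, x⟫_ℝ) • B (b j) (b i)), ← hB]
  simp only [← Finset.smul_sum, ← Finset.sum_smul, ← hnorm]
  module

end OrthonormalBasis

/-- The derivative `x ↦ ⟨x, ∇h x⟩` along the radial vector field. -/
def eulerDeriv (h : E → F) : E → F := vecDeriv (.id ℝ E) h

variable [FiniteDimensional ℝ E]

/-- The part of `‖x‖² Δ` tangent to the spheres, as half the sum of the squares of the derivatives
along the rotations in the coordinate planes of an orthonormal basis; every plane occurs twice. -/
def sphericalLaplacian (h : E → F) (x : E) : F :=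
  (2⁻¹ : ℝ) • ∑ i, ∑ j,
    vecDeriv (rotationGenerator (stdOrthonormalBasis ℝ E i) (stdOrthonormalBasis ℝ E j))
      (vecDeriv (rotationGenerator (stdOrthonormalBasis ℝ E i) (stdOrthonormalBasis ℝ E j)) h) x

lemma norm_sq_smul_laplacian {h : E → F} {x : E} (hh : ContDiffAt ℝ 2 h x) :
    ‖x‖ ^ 2 • Laplacian.laplacian h x =
      eulerDeriv (eulerDeriv h) x + ((Module.finrank ℝ E : ℝ) - 2) • eulerDeriv h x +
        sphericalLaplacian h x := by
  have hlap : Laplacian.laplacian h x = ∑ i, fderiv ℝ (fderiv ℝ h) x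
      (stdOrthonormalBasis ℝ E i) (stdOrthonormalBasis ℝ E i) := by
    simp [InnerProductSpace.laplacian_eq_iteratedFDeriv_stdOrthonormalBasis,
      iteratedFDeriv_two_apply]
  simp only [sphericalLaplacian, eulerDeriv, vecDeriv_vecDeriv _ hh, Finset.sum_add_distrib,
    sum_apply_rotationGenerator_rotationGenerator, ← map_sum,
    sum_rotationGenerator_rotationGenerator, ← hlap, Fintype.card_fin]
  simp only [vecDeriv, ContinuousLinearMap.id_apply, map_smul]
  module

lemma contDiffOn_laplacian {h : E → F} {G : Set E} (hG : IsOpen G) {m n : ℕ∞ω} (hmn : m + 2 ≤ n)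
    (hh : ContDiffOn ℝ n h G) : ContDiffOn ℝ m (Laplacian.laplacian h) G := by
  have hdd : ContDiffOn ℝ m (fderiv ℝ (fderiv ℝ h)) G :=
    (hh.fderiv_of_isOpen hG (m := m + 1) (by rwa [add_assoc, one_add_one_eq_two])).fderiv_of_isOpen
      hG le_rfl
  simp only [InnerProductSpace.laplacian_eq_iteratedFDeriv_stdOrthonormalBasis,
    iteratedFDeriv_two_apply]
  exact ContDiffOn.sum fun i _ => (hdd.clm_apply contDiffOn_const).clm_apply contDiffOn_const

lemma contDiffOn_iterate_laplacian {h : E → F} {G : Set E} (hG : IsOpen G)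
    (hh : ContDiffOn ℝ ∞ h G) (p : ℕ) :
    ContDiffOn ℝ ∞ ((Laplacian.laplacian : (E → F) → E → F)^[p] h) G := by
  induction p with
  | zero => exact hh
  | succ p ih =>
    rw [Function.iterate_succ_apply']
    exact contDiffOn_laplacian hG le_rfl ih

lemma sphericalLaplacian_of_harmonic {y : E → F} {k : ℝ} (hy : ContDiff ℝ 2 y)
    (hΔ : Laplacian.laplacian y = 0) (hk : eulerDeriv y = k • y) :
    sphericalLaplacian y = (-(k * (k + Module.finrank ℝ E - 2))) • y := by
  have hkk : eulerDeriv (eulerDeriv y) = k • k • y := by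
    funext x
    rw [hk]
    change fderiv ℝ (k • y) x x = _
    rw [fderiv_const_smul (hy.differentiable two_ne_zero x)]
    exact congrArg (k • ·) (congrFun hk x)
  funext x
  have hsplit := norm_sq_smul_laplacian (x := x) hy.contDiffAt
  rw [hkk, hk, hΔ] at hsplit
  simp only [Pi.zero_apply, smul_zero, Pi.smul_apply] at hsplit ⊢
  rw [← add_eq_zero_iff_neg_eq.1 hsplit.symm]
  module

variable [MeasurableSpace E] [BorelSpace E] {𝔸 : Type*} [NormedCommRing 𝔸] [NormedAlgebra ℝ 𝔸]

lemma integral_sphere_sphericalLaplacian_mul {G : Set E} (hG : IsOpen G) {r : ℝ}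
    (hS : ∀ θ ∈ Metric.sphere (0 : E) 1, r • θ ∈ G) {h y : E → 𝔸} (hh : ContDiffOn ℝ 2 h G)
    (hy : ContDiff ℝ 2 y) :
    ∫ θ : Metric.sphere (0 : E) 1, sphericalLaplacian h (r • (θ : E)) * y θ
        ∂(volume : Measure E).toSphere =
      ∫ θ : Metric.sphere (0 : E) 1, h (r • (θ : E)) * sphericalLaplacian y θ
        ∂(volume : Measure E).toSphere := by
  have hvh : ∀ A : E →L[ℝ] E, ContDiffOn ℝ 1 (vecDeriv A h) G := fun A =>
    contDiffOn_vecDeriv A hG one_add_one_eq_two.le hh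
  have hvy : ∀ A : E →L[ℝ] E, ContDiff ℝ 1 (vecDeriv A y) := fun A =>
    contDiffOn_univ.1 (contDiffOn_vecDeriv A isOpen_univ one_add_one_eq_two.le hy.contDiffOn)
  have hvvh : ∀ A : E →L[ℝ] E, ContinuousOn (vecDeriv A (vecDeriv A h)) G := fun A =>
    (contDiffOn_vecDeriv A hG (zero_add _).le (hvh A)).continuousOn
  have hvvy : ∀ A : E →L[ℝ] E, Continuous (vecDeriv A (vecDeriv A y)) := fun A =>
    ((hvy A).continuous_fderiv one_ne_zero).clm_apply A.continuous
  simp only [sphericalLaplacian, smul_mul_assoc, mul_smul_comm, Finset.sum_mul, Finset.mul_sum,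
    integral_smul]
  congr 1
  have hint₁ := fun A => integrable_sphere_smul_mul hS (hvvh A) hy.continuous
  have hint₂ := fun A => integrable_sphere_smul_mul hS hh.continuousOn (hvvy A)
  rw [integral_finsetSum _ fun i _ => integrable_finsetSum _ fun j _ => hint₁ _,
    integral_finsetSum _ fun i _ => integrable_finsetSum _ fun j _ => hint₂ _]
  refine Finset.sum_congr rfl fun i _ => ?_
  rw [integral_finsetSum _ fun j _ => hint₁ _, integral_finsetSum _ fun j _ => hint₂ _]
  refine Finset.sum_congr rfl fun j _ => ?_
  have hA := rotationGenerator_mem_skewAdjoint (stdOrthonormalBasis ℝ E i)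
    (stdOrthonormalBasis ℝ E j)
  rw [integral_sphere_vecDeriv_mul hA hG hS (hvh _) (hy.of_le one_le_two),
    integral_sphere_vecDeriv_mul hA hG hS (hh.of_le one_le_two) (hvy _), neg_neg]

end SphericalLaplacian

section LogRadii

variable {E : Type*} [NormedAddCommGroup E] [NormedSpace ℝ E]

/-- The logarithms of the radii of the spheres that are contained in `G`. -/
def logRadii (G : Set E) : Set ℝ := {v | ∀ θ ∈ Metric.sphere (0 : E) 1, Real.exp v • θ ∈ G}

lemma isOpen_logRadii [FiniteDimensional ℝ E] {G : Set E} (hG : IsOpen G) :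
    IsOpen (logRadii G) := by
  have := FiniteDimensional.proper_real E
  refine isOpen_iff_mem_nhds.2 fun v hv =>
    (isCompact_sphere (0 : E) 1).eventually_forall_of_forall_eventually fun θ hθ => ?_
  have hcont : ContinuousAt (fun p : ℝ × E => Real.exp p.1 • p.2) (v, θ) := by fun_prop
  exact hcont.eventually_mem (hG.mem_nhds (hv θ hθ))

end LogRadii

section SphereCoeff

variable {E : Type*} [NormedAddCommGroup E] [InnerProductSpace ℝ E] [FiniteDimensional ℝ E]
  [MeasurableSpace E] [BorelSpace E]

/-- The integral of `θ ↦ h (e^v θ) y(θ)` over the unit sphere. With `y` the complex conjugate of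
`Y_{k,l}` and `h = f` this is the Fourier-Laplace coefficient of `f` in the logarithmic radius. -/
def sphereCoeff (y h : E → ℂ) (v : ℝ) : ℂ :=
  ∫ θ : Metric.sphere (0 : E) 1, h (Real.exp v • (θ : E)) * y θ ∂(volume : Measure E).toSphere

variable {y h : E → ℂ} {G : Set E} {v : ℝ}

lemma norm_sphereCoeff_le (hy : Continuous y) {C : ℝ}
    (hC : ∀ θ ∈ Metric.sphere (0 : E) 1, ‖h (Real.exp v • θ)‖ ≤ C) :
    ‖sphereCoeff y h v‖ ≤
      C * ∫ θ : Metric.sphere (0 : E) 1, ‖y θ‖ ∂(volume : Measure E).toSphere := by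
  rw [← integral_const_mul]
  have hyS : Continuous fun θ : Metric.sphere (0 : E) 1 => C * ‖y θ‖ := by fun_prop
  refine norm_integral_le_of_norm_le
    (hyS.integrable_of_hasCompactSupport (.of_compactSpace _)) (Eventually.of_forall fun θ => ?_)
  rw [norm_mul]
  exact mul_le_mul_of_nonneg_right (hC θ θ.2) (norm_nonneg _)

lemma hasDerivAt_sphereCoeff (hG : IsOpen G) (hh : ContDiffOn ℝ 1 h G) (hy : Continuous y)
    (hv : v ∈ logRadii G) : HasDerivAt (sphereCoeff y h) (sphereCoeff y (eulerDeriv h) v) v := by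
  have hmem : ∀ t ∈ logRadii G, ∀ θ : Metric.sphere (0 : E) 1, Real.exp t • (θ : E) ∈ G :=
    fun t ht θ => ht θ θ.2
  have hyS : Continuous fun θ : Metric.sphere (0 : E) 1 => y θ := hy.comp continuous_subtype_val
  have heuler : ContinuousOn (eulerDeriv h) G :=
    (contDiffOn_vecDeriv _ hG (zero_add _).le hh).continuousOn
  have hderiv := hasDerivAt_setIntegral_of_isCompact (μ := (volume : Measure E).toSphere)
    (F := fun v θ => h (Real.exp v • (θ : E)) * y θ)
    (F' := fun v θ => eulerDeriv h (Real.exp v • (θ : E)) * y θ) isCompact_univ .univ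
    ((isOpen_logRadii hG).mem_nhds hv)
    (fun t ht => ((hh.continuousOn.comp_continuous (by fun_prop) (hmem t ht)).mul
      hyS).continuousOn)
    ((heuler.comp (f := fun p : ℝ × Metric.sphere (0 : E) 1 => Real.exp p.1 • (p.2 : E))
      (Continuous.continuousOn (by fun_prop)) fun p hp => hmem p.1 hp.1 p.2).mul
        (hyS.comp continuous_snd).continuousOn)
    fun t ht θ _ => by
      have hd := ((hh.differentiableOn one_ne_zero).differentiableAt
        (hG.mem_nhds (hmem t ht θ))).hasFDerivAt
      exact (hd.comp_hasDerivAt t ((Real.hasDerivAt_exp t).smul_const (θ : E))).mul_const (y θ)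
  simp only [setIntegral_univ] at hderiv
  exact hderiv

lemma contDiffOn_sphereCoeff (hG : IsOpen G) (hh : ContDiffOn ℝ ∞ h G) (hy : Continuous y) :
    ContDiffOn ℝ ∞ (sphereCoeff y h) (logRadii G) := by
  have hU := isOpen_logRadii hG
  refine contDiffOn_infty.2 fun n => ?_
  induction n generalizing h with
  | zero =>
    exact contDiffOn_zero.2 fun v hv =>
      (hasDerivAt_sphereCoeff hG (hh.of_le (by simp)) hy hv).continuousAt.continuousWithinAt
  | succ n ih =>
    have hderiv : ∀ v ∈ logRadii G,
        HasDerivAt (sphereCoeff y h) (sphereCoeff y (eulerDeriv h) v) v := fun v hv =>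
      hasDerivAt_sphereCoeff hG (hh.of_le (by simp)) hy hv
    refine (contDiffOn_succ_iff_deriv_of_isOpen hU).2
      ⟨fun v hv => (hderiv v hv).differentiableAt.differentiableWithinAt,
        fun hω => absurd hω (WithTop.natCast_ne_top n), ?_⟩
    exact (ih (contDiffOn_vecDeriv _ hG le_rfl hh)).congr fun v hv => (hderiv v hv).deriv

variable {c : ℝ}

lemma exp_mul_sphereCoeff_laplacian (hG : IsOpen G) (hh : ContDiffOn ℝ 2 h G)
    (hy : ContDiff ℝ 2 y) (hyc : sphericalLaplacian y = c • y) (hv : v ∈ logRadii G) :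
    Complex.exp (2 * v) * sphereCoeff y (Laplacian.laplacian h) v =
      sphereCoeff y (eulerDeriv (eulerDeriv h)) v +
        (Module.finrank ℝ E - 2) * sphereCoeff y (eulerDeriv h) v + c * sphereCoeff y h v := by
  have hE : ContDiffOn ℝ 1 (eulerDeriv h) G := contDiffOn_vecDeriv _ hG one_add_one_eq_two.le hh
  have hEE : ContDiffOn ℝ 0 (eulerDeriv (eulerDeriv h)) G :=
    contDiffOn_vecDeriv _ hG (zero_add _).le hE
  have hint : ∀ {g : E → ℂ}, ContinuousOn g G → Integrable
      (fun θ : Metric.sphere (0 : E) 1 => g (Real.exp v • (θ : E)) * y θ)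
      (volume : Measure E).toSphere := fun hg => integrable_sphere_smul_mul hv hg hy.continuous
  have hintE := (hint hE.continuousOn).const_mul ((Module.finrank ℝ E : ℂ) - 2)
  have hintΔ := (hint (contDiffOn_laplacian hG (zero_add _).le hh).continuousOn).const_mul
    (Complex.exp (2 * v))
  have hspherical := integral_sphere_sphericalLaplacian_mul hG hv hh hy
  have hc : (c : ℂ) * sphereCoeff y h v = ∫ θ : Metric.sphere (0 : E) 1,
      sphericalLaplacian h (Real.exp v • (θ : E)) * y θ ∂(volume : Measure E).toSphere := by
    rw [hspherical, hyc, sphereCoeff, ← integral_const_mul]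
    exact integral_congr_ae (Eventually.of_forall fun θ => mul_left_comm _ _ _)
  rw [hc, ← sub_eq_iff_eq_add']
  simp only [sphereCoeff, ← integral_const_mul]
  rw [← integral_add (hint hEE.continuousOn) hintE,
    ← integral_sub hintΔ ((hint hEE.continuousOn).fun_add hintE)]
  refine integral_congr_ae (Eventually.of_forall fun θ => ?_)
  have hradial : ‖Real.exp v • (θ : E)‖ ^ 2 = Real.exp (2 * v) := by
    rw [norm_smul, norm_eq_of_mem_sphere, mul_one, Real.norm_of_nonneg (Real.exp_pos v).le,
      ← Real.exp_nat_mul, Nat.cast_ofNat]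
  have hsplit := norm_sq_smul_laplacian (hh.contDiffAt (hG.mem_nhds (hv θ θ.2)))
  rw [hradial, Complex.real_smul, Complex.real_smul] at hsplit
  push_cast at hsplit
  simp only [← mul_assoc, hsplit]
  ring

variable {lam : ℕ → ℂ}

lemma genDeriv_two_sphereCoeff (hG : IsOpen G) (hh : ContDiffOn ℝ 2 h G) (hy : ContDiff ℝ 2 y)
    (hyc : sphericalLaplacian y = c • y) (hsum : lam 0 + lam 1 = 2 - Module.finrank ℝ E)
    (hprod : lam 0 * lam 1 = c) :
    EqOn (genDeriv lam 2 (sphereCoeff y h))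
      (fun v => Complex.exp (2 * v) * sphereCoeff y (Laplacian.laplacian h) v) (logRadii G) := by
  intro v hv
  have hE : ContDiffOn ℝ 1 (eulerDeriv h) G := contDiffOn_vecDeriv _ hG one_add_one_eq_two.le hh
  have hderiv : ∀ t ∈ logRadii G, deriv (sphereCoeff y h) t = sphereCoeff y (eulerDeriv h) t :=
    fun t ht => (hasDerivAt_sphereCoeff hG (hh.of_le one_le_two) hy.continuous ht).deriv
  have hfirst : EqOn (genDeriv lam 1 (sphereCoeff y h))
      (fun t => sphereCoeff y (eulerDeriv h) t - lam 0 * sphereCoeff y h t) (logRadii G) :=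
    fun t ht => by simp only [genDeriv, hderiv t ht]
  have hsecond : deriv (genDeriv lam 1 (sphereCoeff y h)) v =
      sphereCoeff y (eulerDeriv (eulerDeriv h)) v - lam 0 * sphereCoeff y (eulerDeriv h) v := by
    rw [(hfirst.eventuallyEq_of_mem ((isOpen_logRadii hG).mem_nhds hv)).deriv_eq]
    exact ((hasDerivAt_sphereCoeff hG hE hy.continuous hv).sub
      ((hasDerivAt_sphereCoeff hG (hh.of_le one_le_two) hy.continuous hv).const_mul _)).deriv
  change deriv (genDeriv lam 1 (sphereCoeff y h)) v - lam 1 * genDeriv lam 1 (sphereCoeff y h) v = _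
  simp only [hsecond, hfirst hv, exp_mul_sphereCoeff_laplacian hG hh hy hyc hv]
  linear_combination
    -sphereCoeff y (eulerDeriv h) v * hsum + sphereCoeff y h v * hprod

lemma genDeriv_two_mul_sphereCoeff (hlam : ∀ n, lam (n + 2) = lam n + 2) (hG : IsOpen G)
    (hh : ContDiffOn ℝ ∞ h G) (hy : ContDiff ℝ 2 y) (hyc : sphericalLaplacian y = c • y)
    (hsum : lam 0 + lam 1 = 2 - Module.finrank ℝ E) (hprod : lam 0 * lam 1 = c) (p : ℕ) :
    EqOn (genDeriv lam (2 * p) (sphereCoeff y h))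
      (fun v => Complex.exp (2 * p * v) *
        sphereCoeff y ((Laplacian.laplacian : (E → ℂ) → E → ℂ)^[p] h) v) (logRadii G) := by
  have hU := isOpen_logRadii hG
  induction p with
  | zero => intro v _; simp [genDeriv]
  | succ p ih =>
    intro v hv
    have hcancel : EqOn
        (fun t : ℝ => Complex.exp (-(2 * p) * t) * genDeriv lam (2 * p) (sphereCoeff y h) t)
        (sphereCoeff y ((Laplacian.laplacian : (E → ℂ) → E → ℂ)^[p] h)) (logRadii G) := by
      intro t ht
      simp only [ih ht, ← mul_assoc, ← Complex.exp_add]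
      simp
    have hstep := genDeriv_exp_mul_genDeriv_two_mul hlam hU
      (contDiffOn_sphereCoeff hG hh hy.continuous) p 2 hv
    rw [genDeriv_eqOn hU hcancel 2 hv, genDeriv_two_sphereCoeff hG
      ((contDiffOn_iterate_laplacian hG hh p).of_le ENat.LEInfty.out) hy hyc hsum hprod hv,
      ← Function.iterate_succ_apply' Laplacian.laplacian] at hstep
    beta_reduce at hstep ⊢
    have hexp : Complex.exp (2 * (p + 1 : ℕ) * v) * Complex.exp (-(2 * p) * v) =
        Complex.exp (2 * v) := by
      rw [← Complex.exp_add]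
      congr 1
      push_cast
      ring
    refine mul_left_cancel₀ (Complex.exp_ne_zero (-(2 * p) * v)) ?_
    rw [mul_add, mul_one, ← hstep, ← hexp]
    ring

end SphereCoeff

lemma genDerivGrowth_sphereCoeff {d : ℕ} {G : Set (EuclideanSpace ℝ (Fin d))} {τ : ℝ}
    {f y : EuclideanSpace ℝ (Fin d) → ℂ} {c : ℝ} {lam : ℕ → ℂ} (hG : IsOpen G) (hτ : 0 ≤ τ)
    (hf : IsPolyharmonicOfType G τ f) (hy : ContDiff ℝ 2 y) (hyc : sphericalLaplacian y = c • y)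
    (hlam : ∀ n, lam (n + 2) = lam n + 2) (hsum : lam 0 + lam 1 = 2 - d)
    (hprod : lam 0 * lam 1 = c) {K : Set ℝ} (hKG : K ⊆ logRadii G) (hK : IsCompact K) :
    GenDerivGrowth lam τ (sphereCoeff y f) K := by
  refine genDerivGrowth_of_even hlam (isOpen_logRadii hG)
    (contDiffOn_sphereCoeff hG hf.1 hy.continuous) (fun K hKG hK ρ hρ => ?_) hτ hKG hK
  let shell := (fun p : ℝ × EuclideanSpace ℝ (Fin d) => Real.exp p.1 • p.2) ''
    (K ×ˢ Metric.sphere 0 1)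
  have hshell : IsCompact shell := (hK.prod (isCompact_sphere 0 1)).image (by fun_prop)
  have hshellG : shell ⊆ G := image_subset_iff.2 fun p hp => hKG hp.1 p.2 hp.2
  obtain ⟨C, hC, hbound⟩ := hf.2 shell hshellG hshell (ρ - τ) (sub_pos.2 hρ)
  refine ⟨C * ∫ θ : Metric.sphere (0 : EuclideanSpace ℝ (Fin d)) 1, ‖y θ‖ ∂volume.toSphere,
    by positivity, fun p t ht => ?_⟩
  have hnorm : ‖Complex.exp (2 * p * t)‖ = Real.exp t ^ (2 * p) := by
    rw [Complex.norm_exp, ← Real.exp_nat_mul]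
    norm_num
  rw [genDeriv_two_mul_sphereCoeff hlam hG hf.1 hy hyc (by simpa using hsum) hprod p (hKG ht),
    norm_mul, hnorm]
  have hcoeff := norm_sphereCoeff_le hy.continuous
    fun θ hθ => hbound p _ (mem_image_of_mem _ (mk_mem_prod ht hθ))
  calc _ ≤ _ := mul_le_mul_of_nonneg_left hcoeff (by positivity)
    _ = _ := by rw [add_sub_cancel, mul_pow]; ring

section HarmonicPolynomials

variable {d k : ℕ} {P : MvPolynomial (Fin d) ℂ}

lemma evalReal_C (a : ℂ) : evalReal (MvPolynomial.C a : MvPolynomial (Fin d) ℂ) = fun _ => a :=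
  funext fun _ => MvPolynomial.eval_C a

lemma evalReal_add (P Q : MvPolynomial (Fin d) ℂ) : evalReal (P + Q) = evalReal P + evalReal Q :=
  funext fun _ => map_add _ P Q

lemma evalReal_mul_X (P : MvPolynomial (Fin d) ℂ) (j : Fin d) :
    evalReal (P * MvPolynomial.X j) =
      evalReal P * ⇑(Complex.ofRealCLM.comp (EuclideanSpace.proj j)) :=
  funext fun _ => by simp [evalReal]

lemma contDiff_evalReal (P : MvPolynomial (Fin d) ℂ) {n : WithTop ℕ∞} :
    ContDiff ℝ n (evalReal P) := by
  induction P using MvPolynomial.induction_on with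
  | C a => simpa only [evalReal_C] using contDiff_const
  | add P Q hP hQ => exact evalReal_add P Q ▸ hP.add hQ
  | mul_X P j hP => exact evalReal_mul_X P j ▸ hP.mul (ContinuousLinearMap.contDiff _)

lemma fderiv_evalReal (P : MvPolynomial (Fin d) ℂ) (x w : EuclideanSpace ℝ (Fin d)) :
    fderiv ℝ (evalReal P) x w = ∑ i, w i * evalReal (MvPolynomial.pderiv i P) x := by
  have hdiff : ∀ Q : MvPolynomial (Fin d) ℂ, DifferentiableAt ℝ (evalReal Q) x := fun Q =>
    (contDiff_evalReal Q).differentiable one_ne_zero x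
  induction P using MvPolynomial.induction_on with
  | C a => simp [evalReal_C, evalReal]
  | add P Q hP hQ =>
    rw [evalReal_add, fderiv_add (hdiff P) (hdiff Q), _root_.add_apply, hP, hQ]
    simp [evalReal_add, mul_add, Finset.sum_add_distrib]
  | mul_X P j hP =>
    rw [evalReal_mul_X, fderiv_mul (hdiff P) (ContinuousLinearMap.differentiableAt _)]
    simp [hP, evalReal, MvPolynomial.pderiv_X, Pi.single_apply, mul_add, Finset.sum_add_distrib,
      Finset.mul_sum, apply_ite, mul_comm, mul_left_comm]

lemma laplacian_evalReal (P : MvPolynomial (Fin d) ℂ) :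
    Laplacian.laplacian (evalReal P) = evalReal (polyLaplacian d P) := by
  have hpderiv : ∀ (Q : MvPolynomial (Fin d) ℂ) (i : Fin d),
      (fun x => fderiv ℝ (evalReal Q) x (EuclideanSpace.basisFun (Fin d) ℝ i)) =
        evalReal (MvPolynomial.pderiv i Q) := fun Q i => by
    ext x
    simp [fderiv_evalReal, apply_ite]
  ext x
  rw [InnerProductSpace.laplacian_eq_iteratedFDeriv_orthonormalBasis _
    (EuclideanSpace.basisFun (Fin d) ℝ)]
  have hsecond : ∀ i, iteratedFDeriv ℝ 2 (evalReal P) x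
      ![EuclideanSpace.basisFun (Fin d) ℝ i, EuclideanSpace.basisFun (Fin d) ℝ i] =
      evalReal (MvPolynomial.pderiv i (MvPolynomial.pderiv i P)) x := fun i => by
    rw [← hpderiv, ← hpderiv, iteratedFDeriv_two_apply]
    have hfderiv : DifferentiableAt ℝ (fderiv ℝ (evalReal P)) x :=
      ((contDiff_evalReal P).fderiv_right le_rfl).differentiable one_ne_zero x
    simp [fderiv_clm_apply hfderiv (differentiableAt_const _)]
  simp_rw [hsecond]
  simp [evalReal, polyLaplacian]

lemma eulerDeriv_evalReal (hP : P.IsHomogeneous k) :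
    eulerDeriv (evalReal P) = (k : ℝ) • evalReal P := by
  ext x
  have hsum := congrArg (fun Q => evalReal Q x) hP.sum_X_mul_pderiv
  simpa [eulerDeriv, vecDeriv, fderiv_evalReal, evalReal] using hsum

lemma sphericalLaplacian_evalReal (hP : P ∈ harmonicHomogeneous d k) :
    sphericalLaplacian (evalReal P) = (-(k * (k + d - 2) : ℝ)) • evalReal P := by
  have hΔ : Laplacian.laplacian (evalReal P) = 0 := by
    rw [laplacian_evalReal, LinearMap.mem_ker.1 hP.2]
    exact funext fun x => map_zero _
  simpa using sphericalLaplacian_of_harmonic (contDiff_evalReal P) hΔ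
    (eulerDeriv_evalReal ((MvPolynomial.mem_homogeneousSubmodule k P).1 hP.1))

lemma map_conj_mem_harmonicHomogeneous (hP : P ∈ harmonicHomogeneous d k) :
    MvPolynomial.map (starRingEnd ℂ) P ∈ harmonicHomogeneous d k := by
  refine ⟨((MvPolynomial.mem_homogeneousSubmodule k P).1 hP.1).map _, LinearMap.mem_ker.2 ?_⟩
  have hconj := congrArg (MvPolynomial.map (starRingEnd ℂ)) (LinearMap.mem_ker.1 hP.2)
  simpa [polyLaplacian, MvPolynomial.pderiv_map] using hconj

lemma evalReal_map_conj (P : MvPolynomial (Fin d) ℂ) (x : EuclideanSpace ℝ (Fin d)) :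
    evalReal (MvPolynomial.map (starRingEnd ℂ) P) x = starRingEnd ℂ (evalReal P x) := by
  rw [evalReal, evalReal, MvPolynomial.map_eval]
  simp [Function.comp_def]

lemma fourierLaplaceCoeff_exp (f : EuclideanSpace ℝ (Fin d) → ℂ) (P : MvPolynomial (Fin d) ℂ)
    (v : ℝ) : fourierLaplaceCoeff f P (Real.exp v) =
      sphereCoeff (evalReal (MvPolynomial.map (starRingEnd ℂ) P)) f v := by
  simp only [fourierLaplaceCoeff, sphereCoeff, evalReal_map_conj]

end HarmonicPolynomials

section Exponent

variable (d k : ℕ)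

lemma exponent_add_two (n : ℕ) : exponent d k (n + 2) = exponent d k n + 2 := by
  have hdiv : (n + 2) / 2 = n / 2 + 1 := by omega
  simp only [exponent, Nat.even_add, even_two, iff_true, hdiv]
  split_ifs <;> push_cast <;> ring

lemma exponent_zero : exponent d k 0 = k := by
  simp [exponent]

lemma exponent_one : exponent d k 1 = 2 - (k + d : ℕ) := by
  rw [exponent, if_neg Nat.not_even_one]
  push_cast
  ring

lemma norm_exponent_le (n : ℕ) : ‖exponent d k n‖ ≤ (k + d + 2 : ℝ) + n := by
  induction n using Nat.twoStepInduction with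
  | zero =>
    rw [exponent_zero, Complex.norm_natCast, Nat.cast_zero]
    linarith [(d.cast_nonneg : (0 : ℝ) ≤ d)]
  | one =>
    rw [exponent_one]
    refine (norm_sub_le _ _).trans ?_
    rw [Complex.norm_natCast, Complex.norm_two]
    push_cast
    linarith
  | more n ih _ =>
    rw [exponent_add_two]
    refine (norm_add_le _ _).trans ?_
    rw [Complex.norm_two]
    push_cast
    linarith

end Exponent

section Annulus

variable {d : ℕ} {r₀ : ℝ} {r₁ : EReal}

lemma isOpen_annulus : IsOpen (annulus d r₀ r₁) :=
  (isOpen_lt continuous_const continuous_norm).inter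
    (isOpen_lt (continuous_coe_real_ereal.comp continuous_norm) continuous_const)

lemma mem_logRadii_annulus {v : ℝ} (h₀ : r₀ < Real.exp v) (h₁ : (Real.exp v : EReal) < r₁) :
    v ∈ logRadii (annulus d r₀ r₁) := fun θ hθ => by
  have hnorm : ‖Real.exp v • θ‖ = Real.exp v := by
    rw [norm_smul, mem_sphere_zero_iff_norm.1 hθ, mul_one, Real.norm_of_nonneg (Real.exp_pos v).le]
  simpa only [annulus, mem_ofPred_eq, hnorm] using And.intro h₀ h₁

lemma uIcc_subset_logRadii_annulus {v w : ℝ} (hv₀ : r₀ < Real.exp v)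
    (hv₁ : (Real.exp v : EReal) < r₁) (hw₀ : r₀ < Real.exp w) (hw₁ : (Real.exp w : EReal) < r₁) :
    uIcc v w ⊆ logRadii (annulus d r₀ r₁) := by
  have hconn : OrdConnected {t : ℝ | r₀ < Real.exp t ∧ (Real.exp t : EReal) < r₁} :=
    ⟨fun a ha b hb t ht => ⟨ha.1.trans_le (Real.exp_le_exp.2 ht.1),
      (EReal.coe_le_coe_iff.2 (Real.exp_le_exp.2 ht.2)).trans_lt hb.2⟩⟩
  exact fun t ht => (hconn.uIcc_subset ⟨hv₀, hv₁⟩ ⟨hw₀, hw₁⟩ ht).elim mem_logRadii_annulus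

end Annulus

section FourierLaplaceCoeff

variable {d k : ℕ} {r₀ : ℝ} {r₁ : EReal} {τ : ℝ} {f : EuclideanSpace ℝ (Fin d) → ℂ}
  {P : MvPolynomial (Fin d) ℂ}

lemma genDerivGrowth_fourierLaplaceCoeff (hτ : 0 ≤ τ)
    (hf : IsPolyharmonicOfType (annulus d r₀ r₁) τ f) (hP : P ∈ harmonicHomogeneous d k)
    {K : Set ℝ} (hKG : K ⊆ logRadii (annulus d r₀ r₁)) (hK : IsCompact K) :
    GenDerivGrowth (exponent d k) τ (fun v => fourierLaplaceCoeff f P (Real.exp v)) K := by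
  have hsum : exponent d k 0 + exponent d k 1 = 2 - d := by
    rw [exponent_zero, exponent_one]
    push_cast
    ring
  have hprod : exponent d k 0 * exponent d k 1 = (-(k * (k + d - 2) : ℝ) : ℝ) := by
    rw [exponent_zero, exponent_one]
    push_cast
    ring
  simp only [fourierLaplaceCoeff_exp]
  exact genDerivGrowth_sphereCoeff isOpen_annulus hτ hf (contDiff_evalReal _)
    (sphericalLaplacian_evalReal (map_conj_mem_harmonicHomogeneous hP)) (exponent_add_two d k)
    hsum hprod hKG hK

lemma contDiffOn_fourierLaplaceCoeff_exp (hf : ContDiffOn ℝ ∞ f (annulus d r₀ r₁)) :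
    ContDiffOn ℝ ∞ (fun v => fourierLaplaceCoeff f P (Real.exp v))
      (logRadii (annulus d r₀ r₁)) := by
  simp only [fourierLaplaceCoeff_exp]
  exact contDiffOn_sphereCoeff isOpen_annulus hf (contDiff_evalReal (n := 0) _).continuous

lemma tsum_taylorTerm_fourierLaplaceCoeff_eq (hτ : 0 ≤ τ)
    (hf : IsPolyharmonicOfType (annulus d r₀ r₁) τ f) (hP : P ∈ harmonicHomogeneous d k)
    {v₀ v : ℝ} (h₀ : r₀ < Real.exp v₀) (h₁ : (Real.exp v₀ : EReal) < r₁) (hv₀ : r₀ < Real.exp v)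
    (hv₁ : (Real.exp v : EReal) < r₁) (hv : (v : ℂ) ∈ convergenceDisc τ v₀) :
    ∑' n, taylorTerm (exponent d k) (fun v => fourierLaplaceCoeff f P (Real.exp v)) v₀ n v =
      fourierLaplaceCoeff f P (Real.exp v) := by
  have hsub : uIcc v₀ v ⊆ logRadii (annulus d r₀ r₁) :=
    uIcc_subset_logRadii_annulus h₀ h₁ hv₀ hv₁
  exact (genDerivGrowth_fourierLaplaceCoeff hτ hf hP hsub isCompact_uIcc).tsum_taylorTerm_eq
    (norm_exponent_le d k) hτ hv fun n t ht => differentiableAt_genDeriv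
      (isOpen_logRadii isOpen_annulus) (contDiffOn_fourierLaplaceCoeff_exp hf.1) n (hsub ht)

lemma exists_entire_eq_fourierLaplaceCoeff_exp
    (hf : IsPolyharmonicOfType (annulus d r₀ r₁) 0 f) (hP : P ∈ harmonicHomogeneous d k) :
    ∃ F : ℂ → ℂ, AnalyticOnNhd ℂ F univ ∧ ∀ v : ℝ, r₀ < Real.exp v → (Real.exp v : EReal) < r₁ →
      F v = fourierLaplaceCoeff f P (Real.exp v) := by
  by_cases hne : ∃ v₀ : ℝ, r₀ < Real.exp v₀ ∧ (Real.exp v₀ : EReal) < r₁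
  · obtain ⟨v₀, h₀, h₁⟩ := hne
    have hdisc : convergenceDisc 0 v₀ = univ := if_pos rfl
    have hanalytic := (genDerivGrowth_fourierLaplaceCoeff le_rfl hf hP (singleton_subset_iff.2
      (mem_logRadii_annulus h₀ h₁)) isCompact_singleton).analyticOnNhd_taylorSeries
        (norm_exponent_le d k) le_rfl
    exact ⟨_, hdisc ▸ hanalytic, fun v hv₀ hv₁ => tsum_taylorTerm_fourierLaplaceCoeff_eq le_rfl hf
      hP h₀ h₁ hv₀ hv₁ (hdisc ▸ mem_univ _)⟩
  · exact ⟨0, analyticOnNhd_const, fun v hv₀ hv₁ => (hne ⟨v, hv₀, hv₁⟩).elim⟩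

end FourierLaplaceCoeff

end Polyharmonic

open Polyharmonic in
theorem mainTheorem1_general (d : ℕ) (r₀ : ℝ) (r₁ : EReal) (hr₀ : 0 ≤ r₀) (τ : ℝ)
    (hτ : 0 ≤ τ) (f : EuclideanSpace ℝ (Fin d) → ℂ)
    (hf : IsPolyharmonicOfType (annulus d r₀ r₁) τ f) (k : ℕ) (P : MvPolynomial (Fin d) ℂ)
    (hP : P ∈ harmonicHomogeneous d k)
    (ftilde : ℝ → ℂ) (hftilde : ftilde = fun v => fourierLaplaceCoeff f P (Real.exp v)) :
    (∀ v₀ : ℝ, r₀ < Real.exp v₀ → (Real.exp v₀ : EReal) < r₁ →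
      (∀ z ∈ convergenceDisc τ v₀,
        Summable fun n => ‖taylorTerm (exponent d k) ftilde v₀ n z‖) ∧
      (∀ K ⊆ convergenceDisc τ v₀, IsCompact K →
        TendstoUniformlyOn
          (fun (N : ℕ) (z : ℂ) => ∑ n ∈ Finset.range N, taylorTerm (exponent d k) ftilde v₀ n z)
          (fun z => ∑' n, taylorTerm (exponent d k) ftilde v₀ n z) atTop K) ∧
      AnalyticOnNhd ℂ (fun z => ∑' n, taylorTerm (exponent d k) ftilde v₀ n z)
        (convergenceDisc τ v₀) ∧
      (∀ v : ℝ, r₀ < Real.exp v → (Real.exp v : EReal) < r₁ → (v : ℂ) ∈ convergenceDisc τ v₀ →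
        ∑' n, taylorTerm (exponent d k) ftilde v₀ n (v : ℂ) = ftilde v)) ∧
    (τ = 0 →
      (∃ F : ℂ → ℂ, AnalyticOnNhd ℂ F univ ∧
        ∀ v : ℝ, r₀ < Real.exp v → (Real.exp v : EReal) < r₁ → F (v : ℂ) = ftilde v) ∧
      (∃ H : ℂ → ℂ, AnalyticOnNhd ℂ H Complex.slitPlane ∧
        ∀ r : ℝ, r₀ < r → (r : EReal) < r₁ → H (r : ℂ) = fourierLaplaceCoeff f P r)) := by
  subst hftilde
  refine ⟨fun v₀ h₀ h₁ => ?_, ?_⟩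
  · have hb := norm_exponent_le d k
    have hgrowth := genDerivGrowth_fourierLaplaceCoeff hτ hf hP
      (singleton_subset_iff.2 (mem_logRadii_annulus h₀ h₁)) isCompact_singleton
    exact ⟨fun z => hgrowth.summable_norm_taylorTerm hb hτ,
      fun K => hgrowth.tendstoUniformlyOn_taylorSeries hb hτ,
      hgrowth.analyticOnNhd_taylorSeries hb hτ,
      fun v => tsum_taylorTerm_fourierLaplaceCoeff_eq hτ hf hP h₀ h₁⟩
  · rintro rfl
    obtain ⟨F, hF, hFeq⟩ := exists_entire_eq_fourierLaplaceCoeff_exp hf hP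
    refine ⟨⟨F, hF, hFeq⟩, F ∘ Complex.log,
      hF.comp (fun z => analyticAt_clog) (mapsTo_univ _ _), fun r h₀ h₁ => ?_⟩
    have hr : 0 < r := hr₀.trans_lt h₀
    rw [← Real.exp_log hr] at h₀ h₁
    rw [Function.comp_apply, ← Complex.ofReal_log hr.le, hFeq _ h₀ h₁, Real.exp_log hr]

end

theorem mainTheorem1 (d : ℕ) (hd : 2 ≤ d) (r₀ : ℝ) (r₁ : EReal) (hr₀ : 0 ≤ r₀)
    (hr : (r₀ : EReal) < r₁)
    (Y : ∀ k : ℕ, Module.Basis (Fin (Polyharmonic.harmonicDim d k)) ℂ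
      (Polyharmonic.harmonicHomogeneous d k))
    (hY : ∀ (k : ℕ) (l m : Fin (Polyharmonic.harmonicDim d k)),
      Polyharmonic.sphereInner (Y k l : MvPolynomial (Fin d) ℂ) (Y k m) = if l = m then 1 else 0)
    (τ : ℝ) (hτ : 0 ≤ τ) (f : EuclideanSpace ℝ (Fin d) → ℂ)
    (hf : Polyharmonic.IsPolyharmonicOfType (Polyharmonic.annulus d r₀ r₁) τ f)
    (k : ℕ) (l : Fin (Polyharmonic.harmonicDim d k))
    (fkl : ℝ → ℂ) (hfkl : fkl = Polyharmonic.fourierLaplaceCoeff f (Y k l))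
    (ftilde : ℝ → ℂ) (hftilde : ftilde = fun v => fkl (Real.exp v)) :
    (∀ v₀ : ℝ, r₀ < Real.exp v₀ → ((Real.exp v₀ : ℝ) : EReal) < r₁ →
      -- absolute convergence in the disc
      (∀ z ∈ Polyharmonic.convergenceDisc τ v₀,
        Summable fun n => ‖Polyharmonic.taylorTerm (Polyharmonic.exponent d k) ftilde v₀ n z‖) ∧
      -- uniform convergence on the compact subsets of the disc
      (∀ K ⊆ Polyharmonic.convergenceDisc τ v₀, IsCompact K →
        TendstoUniformlyOn
          (fun (N : ℕ) (z : ℂ) => ∑ n ∈ Finset.range N,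
            Polyharmonic.taylorTerm (Polyharmonic.exponent d k) ftilde v₀ n z)
          (fun z => ∑' n, Polyharmonic.taylorTerm (Polyharmonic.exponent d k) ftilde v₀ n z)
          Filter.atTop K) ∧
      -- the sum is analytic in the disc and extends `ftilde`
      AnalyticOnNhd ℂ
        (fun z => ∑' n, Polyharmonic.taylorTerm (Polyharmonic.exponent d k) ftilde v₀ n z)
        (Polyharmonic.convergenceDisc τ v₀) ∧
      (∀ v : ℝ, r₀ < Real.exp v → ((Real.exp v : ℝ) : EReal) < r₁ →
        (v : ℂ) ∈ Polyharmonic.convergenceDisc τ v₀ →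
        ∑' n, Polyharmonic.taylorTerm (Polyharmonic.exponent d k) ftilde v₀ n (v : ℂ) =
          ftilde v)) ∧
    (τ = 0 →
      -- `ftilde` is the restriction of an entire function
      (∃ F : ℂ → ℂ, AnalyticOnNhd ℂ F Set.univ ∧
        ∀ v : ℝ, r₀ < Real.exp v → ((Real.exp v : ℝ) : EReal) < r₁ → F (v : ℂ) = ftilde v) ∧
      -- `fkl` extends to the complex plane cut along the half line `(-∞, 0]`
      (∃ H : ℂ → ℂ, AnalyticOnNhd ℂ H Complex.slitPlane ∧
        ∀ r : ℝ, r₀ < r → (r : EReal) < r₁ → H (r : ℂ) = fkl r)) := by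
  subst hfkl
  exact mainTheorem1_general d r₀ r₁ hr₀ τ hτ f hf k (Y k l) (Y k l).2 ftilde hftilde
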